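/- Let $q\ge 12/11$ and $\pi_q=\frac{2\pi}{q\sin(\pi/q)}$, and write $\llbracket z\rrbracket^{q-1}=z|z|^{q-2}$ for $z\in\mathbb{R}$. Let $L^2(0,1)$ be the real Hilbert space with its usual inner product $\langle\cdot,\cdot\rangle$ and norm $\|\cdot\|$. For $n\ge1$ let $e_n(x)=\sqrt2\sin(n\pi x)$, put $\widehat g(n)=\langle g,e_n\rangle$ for $g\in L^2(0,1)$, and let $f_n$ be the $n$-th $q$-sine function, that is, the solution on $[0,1]$ of $$-\big(\llbracket u'\rrbracket^{q-1}\big)'=(q-1)\,(n\pi_q)^q\,\llbracket u\rrbracket^{q-1},\qquad u(0)=u(1)=0,$$ normalized by $u'(0)=n\pi_q$. Then the functions $f_n$ exist. There is a bounded linear operator $T_q:L^2(0,1)\to L^2(0,1)$ with bounded inverse such that $T_qe_n=f_n$ for all $n\ge1$, and there are $f_n^*\in L^2(0,1)$, $n\ge 1$ (the dual $q$-sine basis), with $\langle f_j,f_k^*\rangle=\delta_{jk}$ for all $j,k\ge1$. For every $g\in L^2(0,1)$ and every integer $N\ge0$, with $g_N^*=\sum_{j=1}^N\langle g,f_j\rangle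 f_j^*$, $$\|g-g^*_N\|\le\frac{\|T_q^{-1}\|\,\pi_q}{2\sqrt2}\,\Big\|g-\sum_{n=1}^N\widehat g(n)e_n\Big\|.$$ -/

import Mathlib

open MeasureTheory Set

/-- The real Hilbert space `L²(0,1)`. -/
abbrev L2 : Type := Lp ℝ 2 (volume.restrict (Ioo (0 : ℝ) 1))

/-- The number `π_q = 2π / (q sin (π / q))`. -/
noncomputable def piq (q : ℝ) : ℝ :=
  2 * Real.pi / (q * Real.sin (Real.pi / q))

/-- The odd power `⟦z⟧^{q-1} = z |z|^{q-2}` (which is `0` at `z = 0`). -/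
noncomputable def oddPow (q z : ℝ) : ℝ :=
  z * |z| ^ (q - 2)

/-- `u` solves on `[0,1]` the `q`-Laplacian problem
`-(⟦u'⟧^{q-1})' = (q-1) lam ⟦u⟧^{q-1}`, `u(0) = u(1) = 0`.
Derivatives are taken within `[0,1]`, so they are one-sided at the end points. The right-hand side
is continuous, so every solution with `⟦u'⟧^{q-1} ∈ H¹(0,1)` satisfies the equation pointwise. -/
structure IsQLaplaceSolution (q lam : ℝ) (u : ℝ → ℝ) : Prop where
  differentiableOn : DifferentiableOn ℝ u (Icc 0 1)
  equation : ∀ x ∈ Icc (0 : ℝ) 1,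
    HasDerivWithinAt (fun y => oddPow q (derivWithin u (Icc 0 1) y))
      (-((q - 1) * lam * oddPow q (u x))) (Icc 0 1) x
  left : u 0 = 0
  right : u 1 = 0

/-- `u` is, on `[0,1]`, the `n`-th `q`-sine function: the eigenfunction of the `q`-Laplacian for the
eigenvalue `(n π_q)^q`, normalized by `u'(0) = n π_q`. -/
structure IsQSine (q : ℝ) (n : ℕ) (u : ℝ → ℝ) : Prop where
  solution : IsQLaplaceSolution q ((n * piq q) ^ q) u
  normalized : derivWithin u (Icc 0 1) 0 = n * piq q

/-- The `n`-th `q`-sine function `f_n` (`n ≥ 1`); only its values on `[0,1]` are meaningful. -/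
noncomputable def qSine (q : ℝ) (n : ℕ) : ℝ → ℝ :=
  Classical.epsilon (IsQSine q n)

/-- `sin (n π x)` times `√2` is square integrable on `(0,1)`. -/
theorem memLp_sine (n : ℕ) :
    MemLp (fun x : ℝ => √2 * Real.sin (n * Real.pi * x)) 2
      (volume.restrict (Ioo (0 : ℝ) 1)) := by
  refine MemLp.of_bound (C := √2) (by fun_prop) (Filter.Eventually.of_forall fun x => ?_)
  rw [norm_mul, Real.norm_of_nonneg (Real.sqrt_nonneg 2)]
  exact mul_le_of_le_one_right (Real.sqrt_nonneg 2) (Real.abs_sin_le_one _)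

/-- The `2`-sine basis `e_n(x) = √2 sin (n π x)`, `n ≥ 1`, in `L²(0,1)`. -/
noncomputable def sineBasis (n : ℕ) : L2 :=
  (memLp_sine n).toLp _

/-- `f` is the sequence `(f_n)_{n ≥ 1}` of `q`-sine functions, as elements of `L²(0,1)`
(the entry at `0` is irrelevant). -/
def IsQSineSequence (q : ℝ) (f : ℕ → L2) : Prop :=
  ∀ n : ℕ, 1 ≤ n → f n =ᵐ[volume.restrict (Ioo (0 : ℝ) 1)] qSine q n

/-- `fs` is biorthogonal to `f`: `⟨f_j, fs_k⟩ = δ_{jk}` for `j, k ≥ 1`. When the span of the `f_j`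
is dense, this determines `fs_k` for all `k ≥ 1`. -/
def IsDualSequence (f fs : ℕ → L2) : Prop :=
  ∀ j k : ℕ, 1 ≤ j → 1 ≤ k → inner ℝ (f j) (fs k) = if j = k then (1 : ℝ) else 0

/-- The truncated expansion `g*_N = ∑_{j=1}^N ⟨g, f_j⟩ f_j*` in the dual sequence. -/
noncomputable def dualTruncation (f fs : ℕ → L2) (N : ℕ) (g : L2) : L2 :=
  ∑ j ∈ Finset.Icc 1 N, (inner ℝ g (f j) : ℝ) • fs j

/-- The truncated sine Fourier series `∑_{n=1}^N ĝ(n) e_n`, with `ĝ(n) = ⟨g, e_n⟩`. -/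
noncomputable def sineTruncation (N : ℕ) (g : L2) : L2 :=
  ∑ n ∈ Finset.Icc 1 N, (inner ℝ g (sineBasis n) : ℝ) • sineBasis n

/-! The first `q`-sine function extends to an odd 2-periodic function `profile` on the line, and
`f_n(x) = f_1(n x)`. If `a_m` are the sine coefficients of `f_1` and `M_m` is the isometry `e_n ↦
e_{mn}`, then `T = ∑ a_m M_m` sends `e_n` to `f_n` (`dilationSeries_sine`). Everything reduces to
bounds on `∑ |a_m|`.

Norm: integration by parts gives `m π a_m = b_m`, the cosine coefficients of `f_1'`. Only odd `m`
contribute, and `∑ 1/m² = π²/8` over odd `m`. A weighted AM-GM form of Cauchy-Schwarz together with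
Bessel's inequality and `|f_1'| ≤ π_q` then gives `‖T‖ ≤ ∑ |a_m| ≤ π_q / (2√2)`
(`tsum_sineCoeff_le`).

Invertibility: a Neumann series works once `∑_{m ≥ 2} |a_m| < a_1`
(`exists_equiv_eq_dilationSeries`). Cauchy-Schwarz on the tail reduces this to `‖f_1'‖² (π² - 8) <
π² b_1²` (`tsum_sineCoeff_lt`). The energy is bounded through Bernoulli's inequality, `b_1` through
`cos (π x) ≥ 1 - 2x`, and the remaining inequality in `q` is `energy_lt`.

Truncation: `T e_n` lies in the closed span of the multiples `e_{mn}`, so `T` preserves the closed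
span of the `e_n` with `n > N`. With `f_n^* = (T⁻¹)^* e_n` and `Q` the projection onto that tail, `g
- g_N^* = (T⁻¹)^* Q T^* Q g`, which yields the factor `‖T⁻¹‖ ‖T‖` (`norm_sub_dual_truncation_le`).

Since `f_n` is specified only by its boundary value problem, an explicit solution is built by
reparametrizing the circle (`genSin`), and uniqueness is proved although the nonlinearity need not
be Lipschitz (`IsPlanarSolution.eqOn`). -/

theorem norm_sub_truncation_le {H ι : Type*} [NormedAddCommGroup H]
    [InnerProductSpace ℝ H] (e : HilbertBasis ι ℝ H) (s : Finset ι) (x : H) :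
    ‖x - ∑ i ∈ s, (inner ℝ x (e i) : ℝ) • e i‖ ≤ ‖x‖ := by
  set p := ∑ i ∈ s, (inner ℝ x (e i) : ℝ) • e i with hp
  have h : inner ℝ (x - p) p = 0 := by
    rw [inner_sub_left]
    have h1 : inner ℝ x p = ∑ i ∈ s, (inner ℝ x (e i) : ℝ) * inner ℝ x (e i) := by
      simp [hp, inner_sum, inner_smul_right]
    have h2 : inner ℝ p p = ∑ i ∈ s, (inner ℝ x (e i) : ℝ) * inner ℝ x (e i) := by
      rw [hp, e.orthonormal.inner_sum]
      simp
    rw [h1, h2, sub_self]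
  have h3 := norm_add_sq_eq_norm_sq_add_norm_sq_of_inner_eq_zero _ _ h
  rw [sub_add_cancel] at h3
  nlinarith [norm_nonneg (x - p), norm_nonneg p, norm_nonneg x]

/-! ### Series of dilation operators: invertibility and dual truncation. -/

section DilationSeries

variable {H : Type*} [NormedAddCommGroup H] [InnerProductSpace ℝ H] [CompleteSpace H]

/-- The isometry `e n ↦ e (m * n)`. -/
noncomputable def dilation (e : HilbertBasis ℕ+ ℝ H) (m : ℕ+) : H →ₗᵢ[ℝ] H :=
  ((e.orthonormal.comp (fun n => m * n)
    (mul_right_injective m)).orthogonalFamily.linearIsometry).comp e.repr.toLinearIsometry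

theorem dilation_apply (e : HilbertBasis ℕ+ ℝ H) (m n : ℕ+) :
    dilation e m (e n) = e (m * n) := by
  simp [dilation, HilbertBasis.repr_self, OrthogonalFamily.linearIsometry_apply_single]

/-- The operator `∑ₘ aₘ Mₘ`, with `Mₘ` the dilations. -/
noncomputable def dilationSeries (e : HilbertBasis ℕ+ ℝ H) (a : ℕ+ → ℝ) : H →L[ℝ] H :=
  ∑' m, a m • (dilation e m).toContinuousLinearMap

theorem norm_smul_dilation_le (e : HilbertBasis ℕ+ ℝ H) (a : ℝ) (m : ℕ+) :
    ‖a • (dilation e m).toContinuousLinearMap‖ ≤ |a| := by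
  rw [norm_smul, Real.norm_eq_abs]
  exact mul_le_of_le_one_right (abs_nonneg _) (LinearIsometry.norm_toContinuousLinearMap_le _)

theorem summable_dilation (e : HilbertBasis ℕ+ ℝ H) {a : ℕ+ → ℝ} (ha : Summable fun m => |a m|) :
    Summable fun m => a m • (dilation e m).toContinuousLinearMap :=
  Summable.of_norm_bounded ha fun m => norm_smul_dilation_le e (a m) m

theorem norm_dilationSeries_le (e : HilbertBasis ℕ+ ℝ H) {a : ℕ+ → ℝ}
    (ha : Summable fun m => |a m|) : ‖dilationSeries e a‖ ≤ ∑' m, |a m| :=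
  tsum_of_norm_bounded ha.hasSum fun m => norm_smul_dilation_le e (a m) m

theorem hasSum_dilationSeries_apply (e : HilbertBasis ℕ+ ℝ H) {a : ℕ+ → ℝ}
    (ha : Summable fun m => |a m|) (n : ℕ+) :
    HasSum (fun m => a m • e (m * n)) (dilationSeries e a (e n)) := by
  have h := ((summable_dilation e ha).hasSum).mapL (ContinuousLinearMap.apply ℝ H (e n))
  simpa [dilation_apply, dilationSeries] using h

theorem dilation_one (e : HilbertBasis ℕ+ ℝ H) :
    (dilation e 1).toContinuousLinearMap = ContinuousLinearMap.id ℝ H := by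
  have hd := (Submodule.dense_iff_topologicalClosure_eq_top (s := Submodule.span ℝ (range e))).2
    e.dense_span
  refine ContinuousLinearMap.ext_on hd ?_
  rintro _ ⟨n, rfl⟩
  simp [dilation_apply]

/-- The term `m = 1` is `a 1` times the identity, and the hypothesis makes the other terms sum to an
operator of norm below `a 1`. A Neumann series inverts the quotient by `a 1`. -/
theorem exists_equiv_eq_dilationSeries (e : HilbertBasis ℕ+ ℝ H) {a : ℕ+ → ℝ}
    (ha : Summable fun m => |a m|) (h1 : ∑' m, |a m| < 2 * a 1) :
    ∃ T : H ≃L[ℝ] H, (T : H →L[ℝ] H) = dilationSeries e a := by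
  have ha1 : |a 1| ≤ ∑' m, |a m| := ha.le_tsum 1 fun _ _ => abs_nonneg _
  have hpos : 0 < a 1 := by linarith [abs_nonneg (a 1)]
  rw [abs_of_pos hpos] at ha1
  set b : ℕ+ → ℝ := fun m => if m = 1 then 0 else a m with hb
  have hbs : Summable fun m => |b m| := by
    refine Summable.of_nonneg_of_le (fun _ => abs_nonneg _) (fun m => ?_) ha
    by_cases hm : m = 1 <;> simp [hb, hm]
  have hT : dilationSeries e a = a 1 • ContinuousLinearMap.id ℝ H + dilationSeries e b := by
    rw [dilationSeries, (summable_dilation e ha).tsum_eq_add_tsum_ite 1, dilation_one,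
      dilationSeries]
    congr 2
    ext1 m
    by_cases hm : m = 1 <;> simp [hb, hm]
  have hsum : ∑' m, |b m| = ∑' m, |a m| - a 1 := by
    rw [ha.tsum_eq_add_tsum_ite 1, abs_of_pos hpos, add_sub_cancel_left]
    congr 1
    ext1 m
    by_cases hm : m = 1 <;> simp [hb, hm]
  have hnorm : ‖-((a 1)⁻¹ • dilationSeries e b)‖ < 1 := by
    rw [norm_neg, norm_smul, Real.norm_of_nonneg (inv_nonneg.2 hpos.le), inv_mul_lt_iff₀ hpos]
    linarith [norm_dilationSeries_le e hbs]
  let u : (H →L[ℝ] H)ˣ := Units.oneSub _ hnorm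
  let T₁ : H ≃L[ℝ] H := ContinuousLinearEquiv.unitsEquiv ℝ H u
  let T₂ : H ≃L[ℝ] H := ContinuousLinearEquiv.smulLeft (Units.mk0 (a 1) hpos.ne')
  refine ⟨T₁.trans T₂, ?_⟩
  ext x
  have h1 : T₁ x = x + (a 1)⁻¹ • dilationSeries e b x := by
    simp [T₁, u, ContinuousLinearEquiv.unitsEquiv_apply]
  have h2 : ∀ y, T₂ y = a 1 • y := fun y => rfl
  simp only [ContinuousLinearEquiv.coe_coe, ContinuousLinearEquiv.trans_apply, h2, h1, hT]
  simp [smul_smul, hpos.ne']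

/-- If `T` leaves the span of the `e n`, `n ∉ s`, invariant, then truncating the expansion in the
dual of the Riesz basis `T e n` costs at most the condition number of `T`. -/
theorem norm_sub_dual_truncation_le {ι : Type*} (e : HilbertBasis ι ℝ H) (T : H ≃L[ℝ] H)
    (s : Finset ι) (hT : ∀ j ∈ s, ∀ n ∉ s, inner ℝ (e j) (T (e n)) = (0 : ℝ)) (g : H) :
    ‖g - ∑ j ∈ s, (inner ℝ g (T (e j)) : ℝ) •
        ContinuousLinearMap.adjoint (T.symm : H →L[ℝ] H) (e j)‖ ≤
      ‖(T.symm : H →L[ℝ] H)‖ * ‖(T : H →L[ℝ] H)‖ *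
        ‖g - ∑ j ∈ s, (inner ℝ g (e j) : ℝ) • e j‖ := by
  classical
  set A := ContinuousLinearMap.adjoint (T : H →L[ℝ] H)
  set B := ContinuousLinearMap.adjoint (T.symm : H →L[ℝ] H)
  have hBA : ∀ x, B (A x) = x := by
    intro x
    refine ext_inner_right ℝ fun y => ?_
    rw [ContinuousLinearMap.adjoint_inner_left, ContinuousLinearMap.adjoint_inner_left]
    simp
  set Q : H → H := fun x => x - ∑ j ∈ s, (inner ℝ x (e j) : ℝ) • e j with hQ
  have hQadd : ∀ x y, Q (x + y) = Q x + Q y := by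
    intro x y
    simp only [hQ, inner_add_left, add_smul, Finset.sum_add_distrib]
    abel
  -- Dually to the invariance of the tail under `T`, the adjoint `A` maps the span of the `e j`, `j
  -- ∈ s`, into itself, and `Q` annihilates that span.
  have hQA : ∀ j ∈ s, Q (A (e j)) = 0 := by
    intro j hj
    refine e.repr.injective ?_
    ext n
    rw [e.repr_apply_apply, map_zero]
    simp only [hQ, inner_sub_right, inner_sum, inner_smul_right, lp.coeFn_zero, Pi.zero_apply]
    by_cases hn : n ∈ s
    · rw [Finset.sum_eq_single n]
      · simp [real_inner_comm, e.orthonormal.1 n]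
      · intro i _ hi
        rw [e.orthonormal.inner_eq_zero hi.symm, mul_zero]
      · exact fun h => absurd hn h
    · rw [Finset.sum_eq_zero, real_inner_comm, ContinuousLinearMap.adjoint_inner_left]
      · simpa using hT j hj n hn
      · intro i hi
        rw [e.orthonormal.inner_eq_zero (by rintro rfl; exact hn hi), mul_zero]
  have hQsum : Q (A (∑ j ∈ s, (inner ℝ g (e j) : ℝ) • e j)) = 0 := by
    have hQs : ∀ (c : ℝ) x, Q (c • x) = c • Q x := by
      intro c x
      simp only [hQ, inner_smul_left, smul_sub, Finset.smul_sum, smul_smul]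
      rfl
    let Ql : H →+ H := ⟨⟨Q, by simp [hQ]⟩, hQadd⟩
    have : ∀ x, Q x = Ql x := fun _ => rfl
    rw [map_sum, this, map_sum]
    refine Finset.sum_eq_zero fun j hj => ?_
    rw [← this, map_smul, hQs, hQA j hj, smul_zero]
  -- With `P = 1 - Q`, the dual truncation is `B P A g`. Subtracting it from `g = B A g` leaves `B Q
  -- A g`, and `Q A P = 0` allows `g` to be replaced by `Q g`.
  have key : g - ∑ j ∈ s, (inner ℝ g (T (e j)) : ℝ) • B (e j) = B (Q (A (Q g))) := by
    have h1 : Q (A g) = Q (A (Q g)) := by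
      have : A g = A (Q g) + A (∑ j ∈ s, (inner ℝ g (e j) : ℝ) • e j) := by
        rw [← map_add]; simp [hQ]
      rw [this, hQadd, hQsum, add_zero]
    rw [← h1]
    simp only [hQ, map_sub, map_sum, map_smul, hBA]
    simp [A, ContinuousLinearMap.adjoint_inner_left]
  rw [key]
  calc ‖B (Q (A (Q g)))‖ ≤ ‖B‖ * ‖Q (A (Q g))‖ := B.le_opNorm _
    _ ≤ ‖B‖ * ‖A (Q g)‖ := by gcongr; exact norm_sub_truncation_le e s _
    _ ≤ ‖B‖ * (‖A‖ * ‖Q g‖) := by gcongr; exact A.le_opNorm _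
    _ = _ := by simp only [A, B, Q, LinearIsometryEquiv.norm_map, mul_assoc]

end DilationSeries

/-! ### Completeness of the sine system in `L²(0,1)`. -/

section SineBasis

open scoped BoundedContinuousFunction

/-- A bounded continuous function as an element of `L²(0,1)`. -/
noncomputable def toL2 : (ℝ →ᵇ ℝ) →L[ℝ] L2 :=
  BoundedContinuousFunction.toLp 2 (volume.restrict (Ioo (0 : ℝ) 1)) ℝ

theorem coeFn_toL2 (f : ℝ →ᵇ ℝ) : toL2 f =ᵐ[volume.restrict (Ioo (0 : ℝ) 1)] f :=
  BoundedContinuousFunction.coeFn_toLp _ _ _ f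

theorem inner_toL2_right (g : L2) (f : ℝ →ᵇ ℝ) :
    inner ℝ g (toL2 f) = ∫ x in Ioo (0 : ℝ) 1, f x * g x := by
  rw [L2.inner_def]
  refine integral_congr_ae ?_
  filter_upwards [coeFn_toL2 f] with x hx
  rw [hx]
  simp

theorem inner_toL2 (f g : ℝ →ᵇ ℝ) :
    inner ℝ (toL2 f) (toL2 g) = ∫ x in (0 : ℝ)..1, f x * g x := by
  rw [inner_toL2_right, intervalIntegral.integral_of_le zero_le_one, integral_Ioc_eq_integral_Ioo]
  refine integral_congr_ae ?_
  filter_upwards [coeFn_toL2 f] with x hx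
  rw [hx, mul_comm]

/-- `√2 sin (n π x)` as a bounded continuous function. -/
noncomputable def sineFun (n : ℕ) : ℝ →ᵇ ℝ :=
  BoundedContinuousFunction.ofNormedAddCommGroup (fun x => √2 * Real.sin (n * Real.pi * x))
    (by fun_prop) (√2) fun x => by
      rw [norm_mul, Real.norm_of_nonneg (Real.sqrt_nonneg 2)]
      exact mul_le_of_le_one_right (Real.sqrt_nonneg 2) (Real.abs_sin_le_one _)

/-- `√2 cos (n π x)` as a bounded continuous function. -/
noncomputable def cosineFun (n : ℕ) : ℝ →ᵇ ℝ :=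
  BoundedContinuousFunction.ofNormedAddCommGroup (fun x => √2 * Real.cos (n * Real.pi * x))
    (by fun_prop) (√2) fun x => by
      rw [norm_mul, Real.norm_of_nonneg (Real.sqrt_nonneg 2)]
      exact mul_le_of_le_one_right (Real.sqrt_nonneg 2) (Real.abs_cos_le_one _)

theorem sineFun_apply (n : ℕ) (x : ℝ) : sineFun n x = √2 * Real.sin (n * Real.pi * x) := rfl

theorem cosineFun_apply (n : ℕ) (x : ℝ) : cosineFun n x = √2 * Real.cos (n * Real.pi * x) := rfl

theorem norm_sineFun_le (n : ℕ) : ‖sineFun n‖ ≤ √2 :=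
  BoundedContinuousFunction.norm_ofNormedAddCommGroup_le _ (Real.sqrt_nonneg 2) _

theorem toL2_sineFun (n : ℕ) : toL2 (sineFun n) = sineBasis n := by
  refine Lp.ext ((coeFn_toL2 _).trans ?_)
  exact (MemLp.coeFn_toLp (memLp_sine n)).symm

theorem integral_cos_int_mul_pi (k : ℤ) :
    ∫ x in (0 : ℝ)..1, Real.cos (k * Real.pi * x) = if k = 0 then 1 else 0 := by
  split_ifs with h
  · simp [h]
  · have hk : (k * Real.pi : ℝ) ≠ 0 := mul_ne_zero (Int.cast_ne_zero.2 h) Real.pi_ne_zero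
    rw [intervalIntegral.integral_comp_mul_left (fun x => Real.cos x) hk]
    simp [Real.sin_int_mul_pi]

theorem inner_sineFun (m n : ℕ) (hm : m ≠ 0) :
    inner ℝ (toL2 (sineFun m)) (toL2 (sineFun n)) = if m = n then (1 : ℝ) else 0 := by
  rw [inner_toL2]
  have h : ∀ x : ℝ, sineFun m x * sineFun n x =
      Real.cos (((m - n : ℤ) : ℝ) * Real.pi * x) - Real.cos (((m + n : ℤ) : ℝ) * Real.pi * x) := by
    intro x
    rw [sineFun_apply, sineFun_apply]
    push_cast
    rw [sub_mul, sub_mul, add_mul, add_mul, Real.cos_sub, Real.cos_add]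
    linear_combination (Real.sin (m * Real.pi * x) * Real.sin (n * Real.pi * x)) *
      Real.mul_self_sqrt (zero_le_two (α := ℝ))
  simp_rw [h]
  rw [intervalIntegral.integral_sub (Continuous.intervalIntegrable (by fun_prop) _ _)
    (Continuous.intervalIntegrable (by fun_prop) _ _), integral_cos_int_mul_pi,
    integral_cos_int_mul_pi, if_neg (by omega : ¬ (m + n : ℤ) = 0), sub_zero]
  exact if_congr (by omega) rfl rfl

theorem inner_cosineFun (m n : ℕ) (hm : m ≠ 0) :
    inner ℝ (toL2 (cosineFun m)) (toL2 (cosineFun n)) = if m = n then (1 : ℝ) else 0 := by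
  rw [inner_toL2]
  have h : ∀ x : ℝ, cosineFun m x * cosineFun n x =
      Real.cos (((m - n : ℤ) : ℝ) * Real.pi * x) + Real.cos (((m + n : ℤ) : ℝ) * Real.pi * x) := by
    intro x
    rw [cosineFun_apply, cosineFun_apply]
    push_cast
    rw [sub_mul, sub_mul, add_mul, add_mul, Real.cos_sub, Real.cos_add]
    linear_combination (Real.cos (m * Real.pi * x) * Real.cos (n * Real.pi * x)) *
      Real.mul_self_sqrt (zero_le_two (α := ℝ))
  simp_rw [h]
  rw [intervalIntegral.integral_add (Continuous.intervalIntegrable (by fun_prop) _ _)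
    (Continuous.intervalIntegrable (by fun_prop) _ _), integral_cos_int_mul_pi,
    integral_cos_int_mul_pi, if_neg (by omega : ¬ (m + n : ℤ) = 0), add_zero]
  exact if_congr (by omega) rfl rfl

theorem orthonormal_sine : Orthonormal ℝ fun n : ℕ+ => toL2 (sineFun n) := by
  rw [orthonormal_iff_ite]
  intro m n
  rw [inner_sineFun _ _ m.ne_zero]
  simp

theorem orthonormal_cosine : Orthonormal ℝ fun n : ℕ+ => toL2 (cosineFun n) := by
  rw [orthonormal_iff_ite]
  intro m n
  rw [inner_cosineFun _ _ m.ne_zero]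
  simp

/-- Product-to-sum formulas write `sin (nθ) cos^k θ` as a combination of sines. The recursion lowers
`n` by one, so the vanishing function at `n = 0` has to be allowed. -/
theorem inner_sine_mul_cosine_pow {g : L2} (hg : ∀ n : ℕ+, inner ℝ g (toL2 (sineFun n)) = (0 : ℝ))
    (k n : ℕ) : inner ℝ g (toL2 (sineFun n * cosineFun 1 ^ k)) = (0 : ℝ) := by
  induction k generalizing n with
  | zero =>
    rcases Nat.eq_zero_or_pos n with rfl | hn
    · have : sineFun 0 = 0 := by ext x; simp [sineFun_apply]
      simp [this]
    · simpa using hg ⟨n, hn⟩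
  | succ k ih =>
    rcases Nat.eq_zero_or_pos n with rfl | hn
    · have : sineFun 0 = 0 := by ext x; simp [sineFun_apply]
      simp [this]
    · obtain ⟨n, rfl⟩ : ∃ m, n = m + 1 := ⟨n - 1, by omega⟩
      have h : sineFun (n + 1) * cosineFun 1 ^ (k + 1) =
          (√2 / 2) • (sineFun (n + 2) * cosineFun 1 ^ k + sineFun n * cosineFun 1 ^ k) := by
        have h1 : sineFun (n + 1) * cosineFun 1 = (√2 / 2) • (sineFun (n + 2) + sineFun n) := by
          ext x
          simp only [BoundedContinuousFunction.coe_mul, BoundedContinuousFunction.coe_smul,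
            BoundedContinuousFunction.coe_add, Pi.mul_apply, Pi.add_apply, sineFun_apply,
            cosineFun_apply, smul_eq_mul]
          have e1 : ((n + 2 : ℕ) : ℝ) * Real.pi * x =
              ((n + 1 : ℕ) : ℝ) * Real.pi * x + ((1 : ℕ) : ℝ) * Real.pi * x := by
            push_cast; ring
          have e2 : ((n : ℕ) : ℝ) * Real.pi * x =
              ((n + 1 : ℕ) : ℝ) * Real.pi * x - ((1 : ℕ) : ℝ) * Real.pi * x := by
            push_cast; ring
          rw [e1, e2, Real.sin_add, Real.sin_sub]
          ring
        rw [pow_succ', ← mul_assoc, h1, smul_mul_assoc, add_mul]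
      rw [h, map_smul, map_add, inner_smul_right, inner_add_right, ih, ih]
      simp

/-- `cos (π x)` is injective on `[0,1]`, so by Stone-Weierstrass its polynomials are dense in the
continuous functions there. Orthogonality to `sin (π x) cos^k (π x)` therefore passes to `sin (π x)
h(x)`. -/
theorem inner_sine_mul_continuous {g : L2}
    (hg : ∀ n : ℕ+, inner ℝ g (toL2 (sineFun n)) = (0 : ℝ)) (h : C(Icc (0 : ℝ) 1, ℝ)) :
    inner ℝ g (toL2 (sineFun 1 * (BoundedContinuousFunction.mkOfCompact h).compContinuous
      ⟨projIcc 0 1 zero_le_one, continuous_projIcc⟩)) = (0 : ℝ) := by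
  set pr : C(ℝ, Icc (0 : ℝ) 1) := ⟨projIcc 0 1 zero_le_one, continuous_projIcc⟩
  set Φ : C(Icc (0 : ℝ) 1, ℝ) → ℝ := fun h => inner ℝ g
    (toL2 (sineFun 1 * (BoundedContinuousFunction.mkOfCompact h).compContinuous pr)) with hΦ
  have hcont : Continuous Φ := by
    have h1 : Continuous fun h : C(Icc (0 : ℝ) 1, ℝ) => BoundedContinuousFunction.mkOfCompact h :=
      (ContinuousMap.isometryEquivBoundedOfCompact (Icc (0 : ℝ) 1) ℝ).continuous
    have h2 := (BoundedContinuousFunction.continuous_compContinuous (β := ℝ) pr).comp h1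
    exact continuous_const.inner (toL2.continuous.comp (continuous_const.mul h2))
  let c : C(Icc (0 : ℝ) 1, ℝ) := ⟨fun x => √2 * Real.cos (((1 : ℕ) : ℝ) * Real.pi * x), by fun_prop⟩
  have hsep : (Algebra.adjoin ℝ {c}).SeparatesPoints := by
    intro x y hxy
    refine ⟨c, ⟨c, Algebra.subset_adjoin rfl, rfl⟩, fun hc => hxy (Subtype.ext ?_)⟩
    have h2 : Real.cos (Real.pi * x) = Real.cos (Real.pi * y) := by
      have := mul_left_cancel₀ (Real.sqrt_ne_zero'.2 zero_lt_two) hc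
      simpa using this
    have h3 := Real.injOn_cos (x₁ := Real.pi * x) (x₂ := Real.pi * y)
      ⟨by have := x.2.1; positivity, by nlinarith [x.2.2, Real.pi_pos]⟩
      ⟨by have := y.2.1; positivity, by nlinarith [y.2.2, Real.pi_pos]⟩ h2
    exact mul_left_cancel₀ Real.pi_ne_zero h3
  have hA : ∀ a ∈ Algebra.adjoin ℝ {c}, Φ a = 0 := by
    intro a ha
    rw [Algebra.adjoin_singleton_eq_range_aeval] at ha
    obtain ⟨p, rfl⟩ := ha
    have hadd : ∀ u v, Φ (u + v) = Φ u + Φ v := by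
      intro u v
      simp only [hΦ, ← inner_add_right, ← map_add, ← mul_add]
      rfl
    have hsmul : ∀ (r : ℝ) u, Φ (r • u) = r * Φ u := by
      intro r u
      simp only [hΦ, ← inner_smul_right, ← map_smul, ← mul_smul_comm]
      rfl
    induction p using Polynomial.induction_on' with
    | add p q hp hq =>
      simp only [AlgHom.toRingHom_eq_coe, RingHom.coe_coe] at hp hq ⊢
      rw [map_add, hadd, hp, hq, add_zero]
    | monomial n r =>
      simp only [AlgHom.toRingHom_eq_coe, RingHom.coe_coe]
      rw [Polynomial.aeval_monomial, ← Algebra.smul_def, hsmul]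
      refine mul_eq_zero_of_right _ ?_
      refine Eq.trans ?_ (inner_sine_mul_cosine_pow hg n 1)
      simp only [hΦ]
      rw [inner_toL2_right, inner_toL2_right]
      refine setIntegral_congr_fun measurableSet_Ioo fun x hx => ?_
      simp [pr, c, cosineFun_apply, projIcc_of_mem zero_le_one (Ioo_subset_Icc_self hx)]
  have hmem := ContinuousMap.continuousMap_mem_subalgebra_closure_of_separatesPoints _ hsep h
  exact closure_minimal (s := (Algebra.adjoin ℝ {c} : Set C(Icc (0 : ℝ) 1, ℝ))) (t := {x | Φ x = 0})
    hA (isClosed_eq hcont continuous_const) hmem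

/-- Testing against smooth functions shows `g(x) sin (π x) = 0` almost everywhere, and `sin (π x) >
0` on `(0,1)`. -/
theorem eq_zero_of_inner_sine {g : L2}
    (hg : ∀ n : ℕ+, inner ℝ g (toL2 (sineFun n)) = (0 : ℝ)) : g = 0 := by
  have hint : Integrable g (volume.restrict (Ioo (0 : ℝ) 1)) :=
    (Lp.memLp g).integrable (by norm_num)
  have hint' : IntegrableOn (fun x => sineFun 1 x * g x) (Ioo (0 : ℝ) 1) :=
    hint.bdd_mul (c := √2) (sineFun 1).continuous.aestronglyMeasurable
      (Filter.Eventually.of_forall fun x => (BoundedContinuousFunction.norm_coe_le_norm _ x).trans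
        (norm_sineFun_le 1))
  have key := isOpen_Ioo.ae_eq_zero_of_integral_contDiff_smul_eq_zero (μ := volume)
    hint'.locallyIntegrableOn (by
      intro φ hφ _ hsupp
      have h1 := inner_sine_mul_continuous hg ⟨fun x => φ x, by
        exact hφ.continuous.comp continuous_subtype_val⟩
      rw [inner_toL2_right] at h1
      rw [← setIntegral_eq_integral_of_forall_compl_eq_zero (s := Ioo (0 : ℝ) 1)]
      · refine Eq.trans ?_ h1
        refine setIntegral_congr_fun measurableSet_Ioo fun x hx => ?_
        simp [projIcc_of_mem zero_le_one (Ioo_subset_Icc_self hx)]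
        ring
      · intro x hx
        rw [image_eq_zero_of_notMem_tsupport (fun h => hx (hsupp h)), zero_smul])
  refine Lp.ext ?_
  rw [Filter.EventuallyEq, ae_restrict_iff' measurableSet_Ioo]
  have h0 := Lp.coeFn_zero ℝ 2 (volume.restrict (Ioo (0 : ℝ) 1))
  rw [Filter.EventuallyEq, ae_restrict_iff' measurableSet_Ioo] at h0
  filter_upwards [key, h0] with x hx h0 hx'
  rw [h0 hx']
  refine (mul_eq_zero.1 (hx hx')).resolve_left ?_
  have : 0 < Real.sin (Real.pi * x) := by
    refine Real.sin_pos_of_pos_of_lt_pi (mul_pos Real.pi_pos hx'.1) ?_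
    nlinarith [hx'.2, Real.pi_pos]
  simp [sineFun_apply, this.ne']

/-- The sine functions as a Hilbert basis of `L²(0,1)`. -/
noncomputable def sineHilbertBasis : HilbertBasis ℕ+ ℝ L2 :=
  HilbertBasis.mkOfOrthogonalEqBot orthonormal_sine (by
    rw [Submodule.eq_bot_iff]
    intro g hg
    refine eq_zero_of_inner_sine fun n => ?_
    rw [real_inner_comm]
    exact (Submodule.mem_orthogonal _ _).1 hg _ (Submodule.subset_span ⟨n, rfl⟩))

theorem sineHilbertBasis_apply (n : ℕ+) : sineHilbertBasis n = toL2 (sineFun n) := by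
  rw [sineHilbertBasis, HilbertBasis.coe_mkOfOrthogonalEqBot]

end SineBasis

/-! ### Algebra and regularity of odd powers. -/

section OddPow

theorem oddPow_zero (q : ℝ) : oddPow q 0 = 0 := by simp [oddPow]

theorem oddPow_one (q : ℝ) : oddPow q 1 = 1 := by simp [oddPow]

theorem oddPow_two (z : ℝ) : oddPow 2 z = z := by simp [oddPow]

theorem oddPow_neg (q z : ℝ) : oddPow q (-z) = -oddPow q z := by simp [oddPow]

theorem oddPow_mul (q x y : ℝ) : oddPow q (x * y) = oddPow q x * oddPow q y := by
  simp only [oddPow, abs_mul, Real.mul_rpow (abs_nonneg x) (abs_nonneg y)]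
  ring

theorem abs_oddPow {q : ℝ} (hq : 1 < q) (z : ℝ) : |oddPow q z| = |z| ^ (q - 1) := by
  rcases eq_or_ne z 0 with rfl | hz
  · rw [oddPow_zero, abs_zero, Real.zero_rpow (by linarith)]
  · rw [oddPow, abs_mul, abs_of_nonneg (Real.rpow_nonneg (abs_nonneg z) _)]
    nth_rw 1 [← Real.rpow_one |z|]
    rw [← Real.rpow_add (abs_pos.2 hz)]
    congr 1
    ring

theorem oddPow_nonneg {q z : ℝ} (hz : 0 ≤ z) : 0 ≤ oddPow q z :=
  mul_nonneg hz (Real.rpow_nonneg (abs_nonneg z) _)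

theorem oddPow_of_nonneg {q z : ℝ} (hq : 1 < q) (hz : 0 ≤ z) : oddPow q z = z ^ (q - 1) := by
  rw [← abs_of_nonneg (oddPow_nonneg hz : 0 ≤ oddPow q z), abs_oddPow hq, abs_of_nonneg hz]

theorem oddPow_oddPow {a b : ℝ} (hb : 1 < b) (z : ℝ) :
    oddPow a (oddPow b z) = oddPow ((a - 1) * (b - 1) + 1) z := by
  rcases eq_or_ne z 0 with rfl | hz
  · simp [oddPow_zero]
  · rw [oddPow, abs_oddPow hb, oddPow, oddPow, mul_assoc, ← Real.rpow_mul (abs_nonneg z),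
      ← Real.rpow_add (abs_pos.2 hz)]
    congr 2
    ring

/-- For `q < 2` the factor `|z|^(q-2)` is singular at `0`. The product is nevertheless `1/q` times
the derivative of the `C¹` function `|z|^q`. -/
theorem continuous_oddPow {q : ℝ} (hq : 1 < q) : Continuous (oddPow q) := by
  have h : oddPow q = fun z => q⁻¹ * deriv (fun x : ℝ => |x| ^ q) z := by
    ext z
    rw [(hasDerivAt_abs_rpow z hq).deriv, oddPow]
    field_simp
  rw [h]
  have h2 : ContDiff ℝ 1 fun x : ℝ => |x| ^ q := by simpa using contDiff_norm_rpow (E := ℝ) hq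
  exact continuous_const.mul (h2.continuous_deriv le_rfl)

theorem hasDerivAt_oddPow (q : ℝ) {z : ℝ} (hz : z ≠ 0) :
    HasDerivAt (oddPow q) ((q - 1) * |z| ^ (q - 2)) z := by
  have h1 := (hasDerivAt_abs hz).rpow_const (p := q - 2) (Or.inl (abs_ne_zero.2 hz))
  have h2 := (hasDerivAt_id z).mul h1
  refine h2.congr_deriv ?_
  have h3 : |z| ^ (q - 2) = |z| ^ (q - 2 - 1) * |z| := by
    nth_rw 3 [← Real.rpow_one |z|]
    rw [← Real.rpow_add (abs_pos.2 hz)]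
    congr 1
    ring
  have h4 : z * (SignType.sign z : ℝ) = |z| := self_mul_sign z
  simp only [id]
  rw [h3]
  linear_combination (q - 2) * |z| ^ (q - 2 - 1) * h4

end OddPow

/-! ### The generalized angle and its quarter period. -/

section GeneralizedAngle

open Real

theorem integrableOn_beta {a b : ℝ} (ha : 0 < a) (hb : 0 < b) :
    IntegrableOn (fun x : ℝ => x ^ (a - 1) * (1 - x) ^ (b - 1)) (Ioo 0 1) ∧
      ∫ x in Ioo (0 : ℝ) 1, x ^ (a - 1) * (1 - x) ^ (b - 1) = Gamma a * Gamma b / Gamma (a + b) := by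
  have h1 := Complex.betaIntegral_convergent (u := a) (v := b) (by simpa) (by simpa)
  rw [intervalIntegrable_iff_integrableOn_Ioo_of_le zero_le_one] at h1
  have heq : ∀ x ∈ Ioo (0 : ℝ) 1, (x : ℂ) ^ ((a : ℂ) - 1) * (1 - (x : ℂ)) ^ ((b : ℂ) - 1) =
      ((x ^ (a - 1) * (1 - x) ^ (b - 1) : ℝ) : ℂ) := by
    intro x hx
    push_cast [Complex.ofReal_cpow hx.1.le, Complex.ofReal_cpow (sub_nonneg.2 hx.2.le)]
    rfl
  have h2 := h1.congr_fun heq measurableSet_Ioo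
  have h3 : IntegrableOn (fun x : ℝ => x ^ (a - 1) * (1 - x) ^ (b - 1)) (Ioo 0 1) := by
    exact h2.re
  refine ⟨h3, ?_⟩
  have h4 := ProbabilityTheory.beta_eq_betaIntegralReal a b ha hb
  rw [ProbabilityTheory.beta] at h4
  rw [h4, Complex.betaIntegral, intervalIntegral.integral_of_le zero_le_one,
    integral_Ioc_eq_integral_Ioo, setIntegral_congr_fun measurableSet_Ioo heq]
  exact (congrArg Complex.re (integral_ofReal (𝕜 := ℂ))).symm

/-- The density of the generalized angle with respect to the ordinary angle `φ`, when the curve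
`|x|^q + |y|^q = 1` is parametrized by `x = ⟦sin φ⟧^{2/q}`, `y = ⟦cos φ⟧^{2/q}`. -/
noncomputable def angleDensity (q φ : ℝ) : ℝ :=
  2 / q * (|sin φ| ^ (2 / q - 1) * |cos φ| ^ (1 - 2 / q))

theorem angleDensity_image_sin_sq {q : ℝ} (hq : 1 < q) {φ : ℝ} (hφ : φ ∈ Ioo 0 (π / 2)) :
    |2 * sin φ * cos φ| • ((sin φ ^ 2) ^ (1 / q - 1) * (1 - sin φ ^ 2) ^ (1 - 1 / q - 1)) =
      q * angleDensity q φ := by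
  have hs : 0 < sin φ := sin_pos_of_pos_of_lt_pi hφ.1 (by linarith [hφ.2, pi_pos])
  have hc : 0 < cos φ := cos_pos_of_mem_Ioo ⟨by linarith [hφ.1, pi_pos], hφ.2⟩
  have h1 : 1 - sin φ ^ 2 = cos φ ^ 2 := by rw [cos_sq']
  rw [h1, angleDensity, abs_of_pos hs, abs_of_pos hc, abs_of_pos (by positivity), smul_eq_mul,
    ← rpow_natCast, ← rpow_natCast, ← rpow_mul hs.le, ← rpow_mul hc.le]
  have h2 : sin φ ^ (2 / q - 1) = sin φ * sin φ ^ (((2 : ℕ) : ℝ) * (1 / q - 1)) := by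
    nth_rw 2 [← rpow_one (sin φ)]
    rw [← rpow_add hs]
    congr 1
    push_cast
    ring
  have h3 : cos φ ^ (1 - 2 / q) = cos φ * cos φ ^ (((2 : ℕ) : ℝ) * (1 - 1 / q - 1)) := by
    nth_rw 2 [← rpow_one (cos φ)]
    rw [← rpow_add hc]
    congr 1
    push_cast
    ring
  rw [h2, h3]
  field_simp

/-- Substituting `s = sin² φ` turns the integral into `(1/q) B(1/q, 1 - 1/q)`, which Euler's
reflection formula evaluates. -/
theorem integral_angleDensity_quarter {q : ℝ} (hq : 1 < q) :
    IntervalIntegrable (angleDensity q) volume 0 (π / 2) ∧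
      ∫ φ in (0 : ℝ)..π / 2, angleDensity q φ = piq q / 2 := by
  have hq0 : 0 < q := by linarith
  have hpi : (0 : ℝ) ≤ π / 2 := by positivity
  have ha : 0 < 1 / q := by positivity
  have hb : 0 < 1 - 1 / q := by rw [sub_pos, div_lt_one hq0]; exact hq
  obtain ⟨hB, hBv⟩ := integrableOn_beta ha hb
  have himg : (fun φ => sin φ ^ 2) '' Ioo 0 (π / 2) = Ioo 0 1 := by
    ext x
    constructor
    · rintro ⟨φ, hφ, rfl⟩
      have hs : 0 < sin φ := sin_pos_of_pos_of_lt_pi hφ.1 (by linarith [hφ.2, pi_pos])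
      have hc : 0 < cos φ := cos_pos_of_mem_Ioo ⟨by linarith [hφ.1, pi_pos], hφ.2⟩
      exact ⟨by positivity, by nlinarith [sin_sq_add_cos_sq φ]⟩
    · intro hx
      have h0 : 0 < √x := sqrt_pos.2 hx.1
      have h1 : √x < 1 := by rw [sqrt_lt' one_pos]; simpa using hx.2
      refine ⟨arcsin √x, ⟨arcsin_pos.2 h0, arcsin_lt_pi_div_two.2 h1⟩, ?_⟩
      simp only
      rw [sin_arcsin (by linarith) h1.le, sq_sqrt hx.1.le]
  have hinj : InjOn (fun φ => sin φ ^ 2) (Ioo 0 (π / 2)) := by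
    intro x hx y hy hxy
    have hs : ∀ z ∈ Ioo (0 : ℝ) (π / 2), 0 ≤ sin z := fun z hz =>
      (sin_pos_of_pos_of_lt_pi hz.1 (by linarith [hz.2, pi_pos])).le
    have := (sq_eq_sq₀ (hs x hx) (hs y hy)).1 hxy
    exact injOn_sin ⟨by linarith [hx.1, pi_pos], hx.2.le⟩ ⟨by linarith [hy.1, pi_pos], hy.2.le⟩ this
  have hder : ∀ φ ∈ Ioo (0 : ℝ) (π / 2), HasDerivWithinAt (fun φ => sin φ ^ 2)
      (2 * sin φ * cos φ) (Ioo 0 (π / 2)) φ := by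
    intro φ _
    exact ((hasDerivAt_sin φ).fun_pow 2).hasDerivWithinAt.congr_deriv (by simp)
  rw [← himg, integrableOn_image_iff_integrableOn_abs_deriv_smul measurableSet_Ioo hder hinj] at hB
  rw [← himg, integral_image_eq_integral_abs_deriv_smul measurableSet_Ioo hder hinj] at hBv
  have hB' := hB.congr_fun (fun φ hφ => angleDensity_image_sin_sq hq hφ) measurableSet_Ioo
  rw [setIntegral_congr_fun measurableSet_Ioo
    (fun φ hφ => angleDensity_image_sin_sq hq hφ)] at hBv
  constructor
  · rw [intervalIntegrable_iff_integrableOn_Ioo_of_le hpi]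
    have := hB'.const_mul q⁻¹
    simp only [← mul_assoc, inv_mul_cancel₀ hq0.ne', one_mul] at this
    exact this
  · rw [intervalIntegral.integral_of_le hpi, integral_Ioc_eq_integral_Ioo]
    rw [integral_const_mul, add_sub_cancel, Gamma_one, Gamma_mul_Gamma_one_sub] at hBv
    have hs : sin (π / q) ≠ 0 := by
      refine (sin_pos_of_pos_of_lt_pi (by positivity) ?_).ne'
      rw [div_lt_iff₀ hq0]
      nlinarith [pi_pos]
    rw [div_one, mul_one_div] at hBv
    rw [piq]
    field_simp at hBv ⊢
    linarith

end GeneralizedAngle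

/-! ### The functions `sin_q` and `cos_q` on the line. -/

section GeneralizedSine

open Real

theorem angleDensity_periodic (q : ℝ) : Function.Periodic (angleDensity q) π := by
  intro φ
  simp [angleDensity]

theorem angleDensity_neg (q φ : ℝ) : angleDensity q (-φ) = angleDensity q φ := by
  simp [angleDensity]

theorem angleDensity_pi_sub (q φ : ℝ) : angleDensity q (π - φ) = angleDensity q φ := by
  simp [angleDensity]

theorem angleDensity_nonneg {q : ℝ} (hq : 1 < q) (φ : ℝ) : 0 ≤ angleDensity q φ := by
  unfold angleDensity
  positivity

theorem angleDensity_pos {q φ : ℝ} (hq : 1 < q) (hs : sin φ ≠ 0) (hc : cos φ ≠ 0) :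
    0 < angleDensity q φ := by
  unfold angleDensity
  positivity

theorem piq_pos {q : ℝ} (hq : 1 < q) : 0 < piq q := by
  have hs : 0 < sin (π / q) := by
    refine sin_pos_of_pos_of_lt_pi (by positivity) ?_
    rw [div_lt_iff₀ (by linarith)]
    nlinarith [pi_pos]
  unfold piq
  positivity

theorem integral_angleDensity_half {q : ℝ} (hq : 1 < q) :
    IntervalIntegrable (angleDensity q) volume 0 π ∧
      ∫ φ in (0 : ℝ)..π, angleDensity q φ = piq q := by
  obtain ⟨h1, h2⟩ := integral_angleDensity_quarter hq
  have h3 : IntervalIntegrable (angleDensity q) volume (π / 2) π := by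
    have := (h1.comp_sub_left π).symm
    simp only [angleDensity_pi_sub, sub_zero, sub_half] at this
    exact this
  refine ⟨h1.trans h3, ?_⟩
  have h4 : ∫ φ in π / 2..π, angleDensity q φ = ∫ φ in (0 : ℝ)..π / 2, angleDensity q φ := by
    have := intervalIntegral.integral_comp_sub_left (a := 0) (b := π / 2) (angleDensity q) π
    simp only [angleDensity_pi_sub, sub_zero, sub_half] at this
    exact this.symm
  rw [← intervalIntegral.integral_add_adjacent_intervals h1 h3, h4, h2]
  ring

theorem intervalIntegrable_angleDensity {q : ℝ} (hq : 1 < q) (a b : ℝ) :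
    IntervalIntegrable (angleDensity q) volume a b :=
  (angleDensity_periodic q).intervalIntegrable₀ pi_ne_zero (integral_angleDensity_half hq).1 a b

/-- The generalized angle as a function of the ordinary one. -/
noncomputable def genAngle (q φ : ℝ) : ℝ := ∫ t in (0 : ℝ)..φ, angleDensity q t

theorem continuous_genAngle {q : ℝ} (hq : 1 < q) : Continuous (genAngle q) :=
  intervalIntegral.continuous_primitive (intervalIntegrable_angleDensity hq) 0

theorem genAngle_zero (q : ℝ) : genAngle q 0 = 0 := intervalIntegral.integral_same

theorem genAngle_neg (q φ : ℝ) : genAngle q (-φ) = -genAngle q φ := by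
  have h := intervalIntegral.integral_comp_neg (a := 0) (b := φ) (angleDensity q)
  simp only [angleDensity_neg, neg_zero] at h
  rw [genAngle, genAngle, h, intervalIntegral.integral_symm]

theorem genAngle_add_pi {q : ℝ} (hq : 1 < q) (φ : ℝ) :
    genAngle q (φ + π) = genAngle q φ + piq q := by
  rw [genAngle, genAngle, ← (integral_angleDensity_half hq).2,
    ← intervalIntegral.integral_add_adjacent_intervals (intervalIntegrable_angleDensity hq 0 φ)
      (intervalIntegrable_angleDensity hq φ (φ + π)),
    (angleDensity_periodic q).intervalIntegral_add_eq φ 0, zero_add]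

theorem countable_sin_cos_zero : {φ : ℝ | sin φ = 0 ∨ cos φ = 0}.Countable := by
  have h1 : {φ : ℝ | sin φ = 0} = range fun n : ℤ => (n : ℝ) * π := by
    ext φ
    simp [sin_eq_zero_iff]
  have h2 : {φ : ℝ | cos φ = 0} = range fun n : ℤ => (2 * n + 1 : ℝ) * π / 2 := by
    ext φ
    rw [mem_ofPred_eq, cos_eq_zero_iff]
    simp only [mem_range, eq_comm]
  rw [ofPred_or, h1, h2]
  exact (countable_range _).union (countable_range _)

theorem strictMono_genAngle {q : ℝ} (hq : 1 < q) : StrictMono (genAngle q) := by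
  intro a b hab
  have hI := intervalIntegrable_angleDensity hq
  have h := intervalIntegral.integral_add_adjacent_intervals (hI 0 a) (hI a b)
  suffices 0 < ∫ t in a..b, angleDensity q t by
    unfold genAngle
    linarith
  rw [intervalIntegral.integral_pos_iff_support_of_nonneg_ae
    (Filter.Eventually.of_forall fun φ => angleDensity_nonneg hq φ) (hI a b)]
  refine ⟨hab, ?_⟩
  have hsub : Ioc a b \ {φ : ℝ | sin φ = 0 ∨ cos φ = 0} ⊆
      Function.support (angleDensity q) ∩ Ioc a b := by
    rintro φ ⟨h1, h2⟩
    simp only [mem_ofPred_eq, not_or] at h2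
    exact ⟨(angleDensity_pos hq h2.1 h2.2).ne', h1⟩
  refine lt_of_lt_of_le ?_ (measure_mono hsub)
  rw [measure_sdiff_null (countable_sin_cos_zero.measure_zero volume)]
  simpa using hab

theorem surjective_genAngle {q : ℝ} (hq : 1 < q) : Function.Surjective (genAngle q) := by
  have h0 : 0 < ∫ φ in (0 : ℝ)..π, angleDensity q φ := by
    rw [(integral_angleDensity_half hq).2]
    exact piq_pos hq
  exact (continuous_genAngle hq).surjective
    ((angleDensity_periodic q).tendsto_atTop_intervalIntegral_of_pos h0 pi_pos)
    ((angleDensity_periodic q).tendsto_atBot_intervalIntegral_of_pos h0 pi_pos)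

/-- The ordinary angle as a function of the generalized one. -/
noncomputable def ordAngle (q : ℝ) : ℝ → ℝ := Function.invFun (genAngle q)

theorem genAngle_ordAngle {q : ℝ} (hq : 1 < q) (t : ℝ) : genAngle q (ordAngle q t) = t :=
  Function.rightInverse_invFun (surjective_genAngle hq) t

theorem ordAngle_genAngle {q : ℝ} (hq : 1 < q) (φ : ℝ) : ordAngle q (genAngle q φ) = φ :=
  Function.leftInverse_invFun (strictMono_genAngle hq).injective φ

theorem ordAngle_strictMono {q : ℝ} (hq : 1 < q) : StrictMono (ordAngle q) := by
  intro a b hab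
  rw [← (strictMono_genAngle hq).lt_iff_lt, genAngle_ordAngle hq, genAngle_ordAngle hq]
  exact hab

theorem continuous_ordAngle {q : ℝ} (hq : 1 < q) : Continuous (ordAngle q) :=
  (ordAngle_strictMono hq).monotone.continuous_of_surjective
    fun φ => ⟨genAngle q φ, ordAngle_genAngle hq φ⟩

theorem ordAngle_zero {q : ℝ} (hq : 1 < q) : ordAngle q 0 = 0 := by
  have := ordAngle_genAngle hq 0
  rwa [genAngle_zero] at this

theorem ordAngle_neg {q : ℝ} (hq : 1 < q) (t : ℝ) : ordAngle q (-t) = -ordAngle q t := by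
  rw [← ordAngle_genAngle hq (-ordAngle q t), genAngle_neg, genAngle_ordAngle hq]

theorem ordAngle_add_piq {q : ℝ} (hq : 1 < q) (t : ℝ) :
    ordAngle q (t + piq q) = ordAngle q t + π := by
  rw [← ordAngle_genAngle hq (ordAngle q t + π), genAngle_add_pi hq, genAngle_ordAngle hq]

theorem ordAngle_half {q : ℝ} (hq : 1 < q) : ordAngle q (piq q / 2) = π / 2 := by
  rw [← ordAngle_genAngle hq (π / 2), genAngle, (integral_angleDensity_quarter hq).2]

theorem hasDerivAt_ordAngle {q t : ℝ} (hq : 1 < q) (hs : sin (ordAngle q t) ≠ 0)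
    (hc : cos (ordAngle q t) ≠ 0) :
    HasDerivAt (ordAngle q) (angleDensity q (ordAngle q t))⁻¹ t := by
  have hcont : ∀ᶠ φ in nhds (ordAngle q t), ContinuousAt (angleDensity q) φ := by
    filter_upwards [(continuous_sin.continuousAt).eventually_ne hs,
      (continuous_cos.continuousAt).eventually_ne hc] with φ h1 h2
    unfold angleDensity
    refine continuousAt_const.mul (ContinuousAt.mul ?_ ?_)
    · exact (continuous_sin.abs.continuousAt).rpow_const (Or.inl (abs_ne_zero.2 h1))
    · exact (continuous_cos.abs.continuousAt).rpow_const (Or.inl (abs_ne_zero.2 h2))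
  have hmeas : Measurable (angleDensity q) := by
    unfold angleDensity
    fun_prop
  refine HasDerivAt.of_local_left_inverse (f := genAngle q) (continuous_ordAngle hq).continuousAt
    ?_ (angleDensity_pos hq hs hc).ne'
    (Filter.Eventually.of_forall fun y => genAngle_ordAngle hq y)
  exact intervalIntegral.integral_hasDerivAt_right (intervalIntegrable_angleDensity hq _ _)
    hmeas.stronglyMeasurable.stronglyMeasurableAtFilter hcont.self_of_nhds

theorem countable_ordAngle_zero {q : ℝ} (hq : 1 < q) :
    {t : ℝ | sin (ordAngle q t) = 0 ∨ cos (ordAngle q t) = 0}.Countable :=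
  countable_sin_cos_zero.preimage (ordAngle_strictMono hq).injective

/-- A continuous function with continuous derivative candidate that is a derivative off a
countable set is differentiable. -/
theorem hasDerivAt_of_off_countable {f f' : ℝ → ℝ} {s : Set ℝ} (hs : s.Countable)
    (hf : Continuous f) (hf' : Continuous f') (h : ∀ t ∉ s, HasDerivAt f (f' t) t) (t : ℝ) :
    HasDerivAt f (f' t) t := by
  have h1 : ∀ x, f x = f 0 + ∫ y in (0 : ℝ)..x, f' y := by
    intro x
    rw [MeasureTheory.integral_eq_of_hasDerivAt_off_countable f f' hs hf.continuousOn
      (fun y hy => h y hy.2) (hf'.intervalIntegrable _ _)]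
    ring
  rw [funext h1]
  exact (intervalIntegral.integral_hasDerivAt_right (hf'.intervalIntegrable _ _)
    (hf'.stronglyMeasurableAtFilter _ _) hf'.continuousAt).const_add _

/-- The function `sin_q`, defined on the whole line. -/
noncomputable def genSin (q t : ℝ) : ℝ := oddPow (2 / q + 1) (sin (ordAngle q t))

/-- The derivative of `sin_q`. -/
noncomputable def genCos (q t : ℝ) : ℝ := oddPow (2 / q + 1) (cos (ordAngle q t))

theorem continuous_genSin {q : ℝ} (hq : 1 < q) : Continuous (genSin q) := by
  have : 0 < 2 / q := by positivity
  exact (continuous_oddPow (by linarith)).comp (continuous_sin.comp (continuous_ordAngle hq))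

theorem continuous_genCos {q : ℝ} (hq : 1 < q) : Continuous (genCos q) := by
  have : 0 < 2 / q := by positivity
  exact (continuous_oddPow (by linarith)).comp (continuous_cos.comp (continuous_ordAngle hq))

/-- The chain rule applies only where `sin` and `cos` of the angle are nonzero, since the density
may vanish or blow up elsewhere. The exceptional set is countable and the expected derivative is
continuous, so the formula extends. -/
theorem hasDerivAt_genSin {q : ℝ} (hq : 1 < q) (t : ℝ) :
    HasDerivAt (genSin q) (genCos q t) t := by
  refine hasDerivAt_of_off_countable (countable_ordAngle_zero hq) (continuous_genSin hq)
    (continuous_genCos hq) (fun t ht => ?_) t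
  simp only [mem_ofPred_eq, not_or] at ht
  have h1 := ((hasDerivAt_oddPow (2 / q + 1) ht.1).comp _ (hasDerivAt_sin (ordAngle q t))).comp t
    (hasDerivAt_ordAngle hq ht.1 ht.2)
  refine h1.congr_deriv ?_
  have hs := abs_pos.2 ht.1
  have hc := abs_pos.2 ht.2
  rw [angleDensity, genCos, oddPow, show 2 / q + 1 - 2 = 2 / q - 1 by ring,
    show 1 - 2 / q = -(2 / q - 1) by ring, rpow_neg hc.le]
  have hs' : |sin (ordAngle q t)| ^ (2 / q - 1) ≠ 0 := (rpow_pos_of_pos hs _).ne'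
  have hc' : |cos (ordAngle q t)| ^ (2 / q - 1) ≠ 0 := (rpow_pos_of_pos hc _).ne'
  field_simp
  ring

/-- The first argument of `oddPow` is the exponent plus one: raising the exponent `2/q` to `q - 1`
gives `2 - 2/q`. -/
theorem oddPow_genCos {q : ℝ} (hq : 1 < q) (t : ℝ) :
    oddPow q (genCos q t) = oddPow (3 - 2 / q) (cos (ordAngle q t)) := by
  have : 0 < 2 / q := by positivity
  rw [genCos, oddPow_oddPow (by linarith)]
  congr 1
  field_simp
  ring

theorem oddPow_genSin {q : ℝ} (hq : 1 < q) (t : ℝ) :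
    oddPow q (genSin q t) = oddPow (3 - 2 / q) (sin (ordAngle q t)) := by
  have : 0 < 2 / q := by positivity
  rw [genSin, oddPow_oddPow (by linarith)]
  congr 1
  field_simp
  ring

theorem hasDerivAt_oddPow_genCos {q : ℝ} (hq : 1 < q) (t : ℝ) :
    HasDerivAt (fun t => oddPow q (genCos q t)) (-((q - 1) * oddPow q (genSin q t))) t := by
  refine hasDerivAt_of_off_countable (f' := fun t => -((q - 1) * oddPow q (genSin q t)))
    (countable_ordAngle_zero hq) ((continuous_oddPow hq).comp (continuous_genCos hq))
    (continuous_const.mul ((continuous_oddPow hq).comp (continuous_genSin hq))).neg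
    (fun t ht => ?_) t
  simp only [mem_ofPred_eq, not_or] at ht
  have h1 := ((hasDerivAt_oddPow (3 - 2 / q) ht.2).comp _ (hasDerivAt_cos (ordAngle q t))).comp t
    (hasDerivAt_ordAngle hq ht.1 ht.2)
  have h2 : oddPow q ∘ genCos q = (oddPow (3 - 2 / q) ∘ cos) ∘ ordAngle q :=
    funext (oddPow_genCos hq)
  rw [h2, oddPow_genSin hq]
  refine h1.congr_deriv ?_
  have hs := abs_pos.2 ht.1
  have hc := abs_pos.2 ht.2
  rw [angleDensity, oddPow, show 3 - 2 / q - 2 = 1 - 2 / q by ring,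
    show 2 / q - 1 = -(1 - 2 / q) by ring, rpow_neg hs.le]
  have hs' : |sin (ordAngle q t)| ^ (1 - 2 / q) ≠ 0 := (rpow_pos_of_pos hs _).ne'
  have hc' : |cos (ordAngle q t)| ^ (1 - 2 / q) ≠ 0 := (rpow_pos_of_pos hc _).ne'
  field_simp
  ring

theorem genSin_zero {q : ℝ} (hq : 1 < q) : genSin q 0 = 0 := by
  simp [genSin, ordAngle_zero hq, oddPow_zero]

theorem genCos_zero {q : ℝ} (hq : 1 < q) : genCos q 0 = 1 := by
  simp [genCos, ordAngle_zero hq, oddPow_one]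

theorem genSin_half {q : ℝ} (hq : 1 < q) : genSin q (piq q / 2) = 1 := by
  simp [genSin, ordAngle_half hq, oddPow_one]

theorem genSin_neg {q : ℝ} (hq : 1 < q) (t : ℝ) : genSin q (-t) = -genSin q t := by
  simp [genSin, ordAngle_neg hq, oddPow_neg]

theorem genCos_neg {q : ℝ} (hq : 1 < q) (t : ℝ) : genCos q (-t) = genCos q t := by
  simp [genCos, ordAngle_neg hq]

theorem genSin_add_piq {q : ℝ} (hq : 1 < q) (t : ℝ) : genSin q (t + piq q) = -genSin q t := by
  simp [genSin, ordAngle_add_piq hq, oddPow_neg]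

theorem genCos_add_piq {q : ℝ} (hq : 1 < q) (t : ℝ) : genCos q (t + piq q) = -genCos q t := by
  simp [genCos, ordAngle_add_piq hq, oddPow_neg]

theorem genSin_nat_mul_piq {q : ℝ} (hq : 1 < q) (n : ℕ) : genSin q (n * piq q) = 0 := by
  induction n with
  | zero => simp [genSin_zero hq]
  | succ n ih => rw [Nat.cast_succ, add_one_mul, genSin_add_piq hq, ih, neg_zero]

theorem abs_genSin_rpow_add_abs_genCos_rpow {q : ℝ} (hq : 1 < q) (t : ℝ) :
    |genSin q t| ^ q + |genCos q t| ^ q = 1 := by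
  have h : 1 < 2 / q + 1 := by
    have : 0 < 2 / q := by positivity
    linarith
  have h2 : (2 / q + 1 - 1) * q = (2 : ℕ) := by
    push_cast
    field_simp
    ring
  rw [genSin, genCos, abs_oddPow h, abs_oddPow h, ← rpow_mul (abs_nonneg _),
    ← rpow_mul (abs_nonneg _), h2, rpow_natCast, rpow_natCast, sq_abs, sq_abs]
  exact sin_sq_add_cos_sq _

theorem genSin_mem_quarter {q t : ℝ} (hq : 1 < q) (ht : t ∈ Icc 0 (piq q / 2)) :
    0 ≤ genSin q t ∧ 0 ≤ genCos q t := by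
  have h1 : 0 ≤ ordAngle q t := by
    rw [← ordAngle_zero hq]
    exact (ordAngle_strictMono hq).monotone ht.1
  have h2 : ordAngle q t ≤ π / 2 := by
    rw [← ordAngle_half hq]
    exact (ordAngle_strictMono hq).monotone ht.2
  exact ⟨oddPow_nonneg (sin_nonneg_of_nonneg_of_le_pi h1 (by linarith [pi_pos])),
    oddPow_nonneg (cos_nonneg_of_neg_pi_div_two_le_of_le (by linarith [pi_pos]) h2)⟩

end GeneralizedSine

/-! ### Uniqueness for the first-order planar system. -/

section PlanarUniqueness

/-- `(u, v)` solves `u' = a ⟦v⟧^{r-1}`, `v' = b ⟦u⟧^{s-1}` on `[0,1]`. -/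
structure IsPlanarSolution (a b r s : ℝ) (u v : ℝ → ℝ) : Prop where
  fst : ∀ x ∈ Icc (0 : ℝ) 1, HasDerivWithinAt u (a * oddPow r (v x)) (Icc 0 1) x
  snd : ∀ x ∈ Icc (0 : ℝ) 1, HasDerivWithinAt v (b * oddPow s (u x)) (Icc 0 1) x

namespace IsPlanarSolution

variable {a b r s : ℝ} {u v U V : ℝ → ℝ}

theorem swap (h : IsPlanarSolution a b r s u v) : IsPlanarSolution b a s r v u :=
  ⟨h.snd, h.fst⟩

theorem continuousOn_fst (h : IsPlanarSolution a b r s u v) : ContinuousOn u (Icc 0 1) :=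
  fun x hx => (h.fst x hx).continuousWithinAt

theorem energy (h : IsPlanarSolution a b r s u v) (hr : 1 < r) (hs : 1 < s) :
    ∀ x ∈ Icc (0 : ℝ) 1, a * |v x| ^ r / r - b * |u x| ^ s / s =
      a * |v 0| ^ r / r - b * |u 0| ^ s / s := by
  have hd : ∀ x ∈ Icc (0 : ℝ) 1, HasDerivWithinAt
      (fun x => a * |v x| ^ r / r - b * |u x| ^ s / s) 0 (Icc 0 1) x := by
    intro x hx
    have h1 := (((hasDerivAt_abs_rpow (v x) hr).comp_hasDerivWithinAt x (h.snd x hx)).const_mul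
      a).div_const r
    have h2 := (((hasDerivAt_abs_rpow (u x) hs).comp_hasDerivWithinAt x (h.fst x hx)).const_mul
      b).div_const s
    refine (h1.sub h2).congr_deriv ?_
    unfold oddPow
    field_simp
    ring
  refine constant_of_has_deriv_right_zero (fun x hx => (hd x hx).continuousWithinAt) fun x hx => ?_
  exact (hd x (Ico_subset_Icc_self hx)).mono_of_mem_nhdsWithin
    (Icc_mem_nhdsGE_of_mem hx)

/-- Where `v ≠ 0`, energy conservation determines `|v|` from `u`, and the sign of `v` is locally
constant. The system becomes the scalar equation `u' = F(u)` with `F` of class `C¹` near `u x₀`, to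
which Lipschitz uniqueness applies. -/
theorem eventually_eq (h : IsPlanarSolution a b r s u v) (H : IsPlanarSolution a b r s U V)
    (hr : 1 < r) (hs : 1 < s) (ha : a ≠ 0) (hu0 : u 0 = U 0) (hv0 : v 0 = V 0) {x₀ : ℝ}
    (hx₀ : x₀ ∈ Ico (0 : ℝ) 1) (hu : u x₀ = U x₀) (hv : v x₀ = V x₀) (hne : v x₀ ≠ 0) :
    ∀ᶠ x in nhdsWithin x₀ (Ioi x₀), u x = U x ∧ v x = V x := by
  obtain ⟨E, hE⟩ : ∃ E, E = a * |v 0| ^ r / r - b * |u 0| ^ s / s := ⟨_, rfl⟩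
  have hen : ∀ x ∈ Icc (0 : ℝ) 1, |v x| ^ r = r / a * (E + b * |u x| ^ s / s) := by
    intro x hx
    rw [hE, ← h.energy hr hs x hx]
    field_simp
    ring
  have hEN : ∀ x ∈ Icc (0 : ℝ) 1, |V x| ^ r = r / a * (E + b * |U x| ^ s / s) := by
    intro x hx
    rw [hE, hu0, hv0, ← H.energy hr hs x hx]
    field_simp
    ring
  -- `σ` is the sign of `v x₀`, which fixes the branch when `v` is recovered from `|v|^r`.
  obtain ⟨σ, hσ, hσv⟩ : ∃ σ : ℝ, (σ = 1 ∨ σ = -1) ∧ 0 < σ * v x₀ := by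
    rcases hne.lt_or_gt with h | h
    · exact ⟨-1, Or.inr rfl, by linarith⟩
    · exact ⟨1, Or.inl rfl, by linarith⟩
  have hodd : ∀ z : ℝ, 0 < σ * z → oddPow r z = σ * (|z| ^ r) ^ ((r - 1) / r) := by
    intro z hz
    rw [← Real.rpow_mul (abs_nonneg z), mul_div_cancel₀ _ (by linarith : r ≠ 0), ← abs_oddPow hr]
    rcases hσ with rfl | rfl
    · rw [abs_of_nonneg (oddPow_nonneg (by linarith)), one_mul]
    · rw [← abs_neg, ← oddPow_neg, abs_of_nonneg (oddPow_nonneg (by linarith)), oddPow_neg]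
      ring
  set F : ℝ → ℝ := fun y => a * (σ * (r / a * (E + b * |y| ^ s / s)) ^ ((r - 1) / r)) with hF
  have hx₀' := Ico_subset_Icc_self hx₀
  have hFd : ContDiffAt ℝ 1 F (u x₀) := by
    have h2 : ContDiff ℝ 1 fun x : ℝ => |x| ^ s := by simpa using contDiff_norm_rpow (E := ℝ) hs
    have h3 : ContDiff ℝ 1 fun y : ℝ => r / a * (E + b * |y| ^ s / s) :=
      contDiff_const.mul (contDiff_const.add ((contDiff_const.mul h2).div_const s))
    have h4 : r / a * (E + b * |u x₀| ^ s / s) ≠ 0 := by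
      rw [← hen x₀ hx₀']
      exact (Real.rpow_pos_of_pos (abs_pos.2 hne) r).ne'
    exact contDiffAt_const.mul (contDiffAt_const.mul
      (h3.contDiffAt.rpow_const_of_ne h4))
  obtain ⟨K, t, ht, hK⟩ := hFd.exists_lipschitzOnWith
  have hIcc : Icc (0 : ℝ) 1 ∈ nhdsWithin x₀ (Ici x₀) := Icc_mem_nhdsGE_of_mem hx₀
  have hlim : ∀ {f : ℝ → ℝ}, ContinuousOn f (Icc 0 1) →
      Filter.Tendsto f (nhdsWithin x₀ (Ici x₀)) (nhds (f x₀)) := by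
    intro f hf
    exact (hf x₀ hx₀').mono_left (nhdsWithin_le_of_mem hIcc)
  have ev : ∀ᶠ x in nhdsWithin x₀ (Ici x₀), x ∈ Icc (0 : ℝ) 1 ∧ u x ∈ t ∧ U x ∈ t ∧
      0 < σ * v x ∧ 0 < σ * V x := by
    refine (Filter.eventually_of_mem hIcc fun _ hx => hx).and (((hlim h.continuousOn_fst).eventually_mem ht).and
      (((hlim H.continuousOn_fst).eventually_mem (hu ▸ ht)).and (Filter.Eventually.and ?_ ?_)))
    · exact ((hlim h.swap.continuousOn_fst).const_mul σ).eventually (lt_mem_nhds hσv)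
    · exact ((hlim H.swap.continuousOn_fst).const_mul σ).eventually (lt_mem_nhds (hv ▸ hσv))
  obtain ⟨x₁, hx₁, hsub⟩ := mem_nhdsGE_iff_exists_Icc_subset.1 ev
  have hder : ∀ {u v : ℝ → ℝ}, IsPlanarSolution a b r s u v →
      (∀ x ∈ Icc (0 : ℝ) 1, |v x| ^ r = r / a * (E + b * |u x| ^ s / s)) →
      (∀ x ∈ Icc x₀ x₁, x ∈ Icc (0 : ℝ) 1 ∧ 0 < σ * v x) →
      ∀ x ∈ Ico x₀ x₁, HasDerivWithinAt u (F (u x)) (Ici x) x := by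
    intro u v h hen hx' x hx
    have hxI := hx' x (Ico_subset_Icc_self hx)
    have hx1 : x ∈ Ico (0 : ℝ) 1 :=
      ⟨hxI.1.1, hx.2.trans_le (hx' x₁ ⟨le_of_lt hx₁, le_rfl⟩).1.2⟩
    have := (h.fst x hxI.1).mono_of_mem_nhdsWithin (Icc_mem_nhdsGE_of_mem hx1)
    rwa [hodd _ hxI.2, hen x hxI.1] at this
  have hEq : EqOn u U (Icc x₀ x₁) :=
    ODE_solution_unique_of_mem_Icc_right (v := fun _ => F) (s := fun _ => t) (K := K)
      (fun _ _ => hK)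
      (h.continuousOn_fst.mono fun x hx => (hsub hx).1)
      (hder h hen fun x hx => ⟨(hsub hx).1, (hsub hx).2.2.2.1⟩)
      (fun x hx => (hsub (Ico_subset_Icc_self hx)).2.1)
      (H.continuousOn_fst.mono fun x hx => (hsub hx).1)
      (hder H hEN fun x hx => ⟨(hsub hx).1, (hsub hx).2.2.2.2⟩)
      (fun x hx => (hsub (Ico_subset_Icc_self hx)).2.2.1) hu
  filter_upwards [Ioc_mem_nhdsGT hx₁] with x hx
  have hx' := Ioc_subset_Icc_self hx
  refine ⟨hEq hx', ?_⟩
  obtain ⟨hx01, -, -, hp1, hp2⟩ := hsub hx'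
  have h1 : |v x| ^ r = |V x| ^ r := by rw [hen x hx01, hEN x hx01, hEq hx']
  have h2 : |v x| = |V x| := (Real.rpow_left_inj (abs_nonneg _) (abs_nonneg _) (by linarith)).1 h1
  rcases abs_eq_abs.1 h2 with h3 | h3
  · exact h3
  · rw [h3] at hp1
    linarith

/-- The agreement set is closed. A nonzero energy prevents `u` and `v` from vanishing together, so
at each of its points in `[0,1)` either `eventually_eq` or its version with `u` and `v` exchanged
continues it to the right. -/
theorem eqOn (h : IsPlanarSolution a b r s u v) (H : IsPlanarSolution a b r s U V)
    (hr : 1 < r) (hs : 1 < s) (ha : a ≠ 0) (hb : b ≠ 0) (hu0 : u 0 = U 0) (hv0 : v 0 = V 0)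
    (hE : a * |v 0| ^ r / r - b * |u 0| ^ s / s ≠ 0) : EqOn u U (Icc 0 1) := by
  have hcl : IsClosed ({x | u x = U x ∧ v x = V x} ∩ Icc 0 1) := by
    have h1 := (h.continuousOn_fst.prodMk h.swap.continuousOn_fst).sub
      (H.continuousOn_fst.prodMk H.swap.continuousOn_fst)
    have h2 := h1.preimage_isClosed_of_isClosed isClosed_Icc (isClosed_singleton (x := 0))
    convert h2 using 1
    ext x
    simp [sub_eq_zero, and_comm]
  have key := hcl.Icc_subset_of_forall_mem_nhdsWithin ⟨hu0, hv0⟩ (by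
    rintro x ⟨⟨hux, hvx⟩, hx⟩
    by_cases hv : v x = 0
    · have hu : u x ≠ 0 := by
        intro hu
        apply hE
        rw [← h.energy hr hs x (Ico_subset_Icc_self hx), hu, hv, abs_zero,
          Real.zero_rpow (by linarith), Real.zero_rpow (by linarith)]
        simp
      filter_upwards [h.swap.eventually_eq H.swap hs hr hb hv0 hu0 hx hvx hux hu] with y hy
      exact ⟨hy.2, hy.1⟩
    · exact h.eventually_eq H hr hs ha hu0 hv0 hx hux hvx hv)
  exact fun x hx => (key hx).1

end IsPlanarSolution

end PlanarUniqueness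

/-! ### Existence and uniqueness of the `q`-sine functions. -/

section QSine

/-- With `v = ⟦u'⟧^{q-1}`, inverting the odd power uses the conjugate exponent `q/(q-1)`. -/
theorem IsQSine.isPlanarSolution {q : ℝ} (hq : 1 < q) {n : ℕ} {u : ℝ → ℝ} (h : IsQSine q n u) :
    IsPlanarSolution 1 (-((q - 1) * (n * piq q) ^ q)) (q / (q - 1)) q u
      fun x => oddPow q (derivWithin u (Icc 0 1) x) := by
  refine ⟨fun x hx => ?_, fun x hx => ?_⟩
  · have h1 : (q / (q - 1) - 1) * (q - 1) + 1 = 2 := by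
      have : q - 1 ≠ 0 := by linarith
      field_simp
      ring
    rw [oddPow_oddPow hq, h1, oddPow_two, one_mul]
    exact (h.solution.differentiableOn x hx).hasDerivWithinAt
  · exact (h.solution.equation x hx).congr_deriv (by ring)

theorem IsQSine.eqOn {q : ℝ} (hq : 1 < q) {n : ℕ} (hn : 1 ≤ n) {u U : ℝ → ℝ} (h : IsQSine q n u)
    (H : IsQSine q n U) : EqOn u U (Icc 0 1) := by
  have hpos : 0 < n * piq q := mul_pos (by exact_mod_cast hn) (piq_pos hq)
  have hr : 1 < q / (q - 1) := by
    rw [one_lt_div (by linarith)]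
    linarith
  have hb : 0 < (q - 1) * (n * piq q) ^ q :=
    mul_pos (by linarith) (Real.rpow_pos_of_pos hpos q)
  refine (h.isPlanarSolution hq).eqOn (H.isPlanarSolution hq) hr hq one_ne_zero
    (neg_ne_zero.2 hb.ne') (by rw [h.solution.left, H.solution.left])
    (by rw [h.normalized, H.normalized]) ?_
  simp only [h.normalized, h.solution.left, abs_zero]
  rw [Real.zero_rpow (by linarith), abs_oddPow hq, mul_zero, zero_div, sub_zero, one_mul]
  have : 0 < |(n * piq q : ℝ)| := abs_pos.2 hpos.ne'
  positivity

theorem isQSine_genSin {q : ℝ} (hq : 1 < q) {n : ℕ} (hn : 1 ≤ n) :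
    IsQSine q n fun x => genSin q (n * piq q * x) := by
  have hpos : 0 < n * piq q := mul_pos (by exact_mod_cast hn) (piq_pos hq)
  have hlin : ∀ x, HasDerivAt (fun x => n * piq q * x) (n * piq q) x := fun x => by
    simpa using (hasDerivAt_id x).const_mul (n * piq q)
  have hd : ∀ x, HasDerivAt (fun x => genSin q (n * piq q * x))
      (genCos q (n * piq q * x) * (n * piq q)) x := fun x =>
    (hasDerivAt_genSin hq _).comp x (hlin x)
  have hdw : ∀ x ∈ Icc (0 : ℝ) 1, derivWithin (fun x => genSin q (n * piq q * x)) (Icc 0 1) x =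
      genCos q (n * piq q * x) * (n * piq q) := fun x hx =>
    (hd x).hasDerivWithinAt.derivWithin (uniqueDiffOn_Icc_zero_one x hx)
  refine ⟨⟨fun x _ => (hd x).differentiableAt.differentiableWithinAt, fun x hx => ?_, ?_, ?_⟩, ?_⟩
  · have h1 := (((hasDerivAt_oddPow_genCos hq _).comp x (hlin x)).mul_const
      (oddPow q (n * piq q))).hasDerivWithinAt (s := Icc 0 1)
    refine (h1.congr (fun y hy => ?_) ?_).congr_deriv ?_
    · rw [hdw y hy, oddPow_mul]
      rfl
    · rw [hdw x hx, oddPow_mul]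
      rfl
    · have h2 : (n * piq q) ^ q = n * piq q * oddPow q (n * piq q) := by
        rw [oddPow_of_nonneg hq hpos.le]
        nth_rw 2 [← Real.rpow_one (n * piq q)]
        rw [← Real.rpow_add hpos]
        congr 1
        ring
      rw [h2]
      ring
  · simp [genSin_zero hq]
  · simp [genSin_nat_mul_piq hq]
  · rw [hdw 0 (left_mem_Icc.2 zero_le_one)]
    simp [genCos_zero hq]

theorem isQSine_qSine {q : ℝ} (hq : 1 < q) {n : ℕ} (hn : 1 ≤ n) : IsQSine q n (qSine q n) :=
  Classical.epsilon_spec ⟨_, isQSine_genSin hq hn⟩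

/-- `qSine` is an arbitrary choice among solutions; uniqueness identifies it with the explicit one.
-/
theorem qSine_eqOn {q : ℝ} (hq : 1 < q) {n : ℕ} (hn : 1 ≤ n) :
    EqOn (qSine q n) (fun x => genSin q (n * piq q * x)) (Icc 0 1) :=
  (isQSine_qSine hq hn).eqOn hq hn (isQSine_genSin hq hn)

end QSine

/-! ### Estimates for the first `q`-sine function and its coefficients. -/

section Profile

open Real

/-- `sin_q (π_q x)`, the first `q`-sine function on the whole line. -/
noncomputable def profile (q x : ℝ) : ℝ := genSin q (piq q * x)

/-- The derivative of `sin_q (π_q x)`. -/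
noncomputable def profileDeriv (q x : ℝ) : ℝ := piq q * genCos q (piq q * x)

variable {q : ℝ}

theorem hasDerivAt_profile (hq : 1 < q) (x : ℝ) :
    HasDerivAt (profile q) (profileDeriv q x) x := by
  have h : HasDerivAt (fun x => piq q * x) (piq q) x := by
    simpa using (hasDerivAt_id x).const_mul (piq q)
  exact ((hasDerivAt_genSin hq _).comp x h).congr_deriv (mul_comm _ _)

theorem continuous_profile (hq : 1 < q) : Continuous (profile q) :=
  (continuous_genSin hq).comp (continuous_const.mul continuous_id)

theorem continuous_profileDeriv (hq : 1 < q) : Continuous (profileDeriv q) :=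
  continuous_const.mul ((continuous_genCos hq).comp (continuous_const.mul continuous_id))

theorem profile_zero (hq : 1 < q) : profile q 0 = 0 := by simp [profile, genSin_zero hq]

theorem profile_half (hq : 1 < q) : profile q (1 / 2) = 1 := by
  rw [profile, mul_one_div, genSin_half hq]

theorem profile_neg (hq : 1 < q) (x : ℝ) : profile q (-x) = -profile q x := by
  rw [profile, mul_neg, genSin_neg hq, profile]

theorem profile_add_one (hq : 1 < q) (x : ℝ) : profile q (x + 1) = -profile q x := by
  rw [profile, mul_add, mul_one, genSin_add_piq hq, profile]

theorem profile_one_sub (hq : 1 < q) (x : ℝ) : profile q (1 - x) = profile q x := by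
  rw [sub_eq_neg_add, profile_add_one hq, profile_neg hq, neg_neg]

theorem profile_one (hq : 1 < q) : profile q 1 = 0 := by
  rw [← sub_zero 1, profile_one_sub hq, profile_zero hq]

theorem profileDeriv_one_sub (hq : 1 < q) (x : ℝ) :
    profileDeriv q (1 - x) = -profileDeriv q x := by
  rw [profileDeriv, profileDeriv, mul_sub, mul_one, sub_eq_neg_add, genCos_add_piq hq,
    genCos_neg hq, mul_neg]

theorem abs_genSin_le_one (hq : 1 < q) (t : ℝ) : |genSin q t| ≤ 1 := by
  have h := abs_genSin_rpow_add_abs_genCos_rpow hq t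
  have h2 : 0 ≤ |genCos q t| ^ q := by positivity
  by_contra! h3
  linarith [one_lt_rpow h3 (by linarith : 0 < q)]

theorem abs_genCos_le_one (hq : 1 < q) (t : ℝ) : |genCos q t| ≤ 1 := by
  have h := abs_genSin_rpow_add_abs_genCos_rpow hq t
  have h2 : 0 ≤ |genSin q t| ^ q := by positivity
  by_contra! h3
  linarith [one_lt_rpow h3 (by linarith : 0 < q)]

theorem abs_profile_le_one (hq : 1 < q) (x : ℝ) : |profile q x| ≤ 1 := abs_genSin_le_one hq _

theorem abs_profileDeriv_le (hq : 1 < q) (x : ℝ) : |profileDeriv q x| ≤ piq q := by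
  rw [profileDeriv, abs_mul, abs_of_pos (piq_pos hq)]
  exact mul_le_of_le_one_right (piq_pos hq).le (abs_genCos_le_one hq _)

theorem piq_mul_mem_quarter (hq : 1 < q) {x : ℝ} (hx : x ∈ Icc (0 : ℝ) (1 / 2)) :
    piq q * x ∈ Icc 0 (piq q / 2) := by
  have := piq_pos hq
  exact ⟨mul_nonneg this.le hx.1, by nlinarith [hx.2]⟩

theorem profile_nonneg (hq : 1 < q) {x : ℝ} (hx : x ∈ Icc (0 : ℝ) (1 / 2)) : 0 ≤ profile q x :=
  (genSin_mem_quarter hq (piq_mul_mem_quarter hq hx)).1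

theorem profileDeriv_nonneg (hq : 1 < q) {x : ℝ} (hx : x ∈ Icc (0 : ℝ) (1 / 2)) :
    0 ≤ profileDeriv q x :=
  mul_nonneg (piq_pos hq).le (genSin_mem_quarter hq (piq_mul_mem_quarter hq hx)).2

theorem antitoneOn_profileDeriv (hq : 1 < q) : AntitoneOn (profileDeriv q) (Icc 0 (1 / 2)) := by
  intro x hx y hy hxy
  have h0 : 0 < 2 / q := by positivity
  have hmem : ∀ z ∈ Icc (0 : ℝ) (1 / 2), ordAngle q (piq q * z) ∈ Icc 0 (π / 2) := by
    intro z hz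
    have := piq_mul_mem_quarter hq hz
    constructor
    · rw [← ordAngle_zero hq]
      exact (ordAngle_strictMono hq).monotone this.1
    · rw [← ordAngle_half hq]
      exact (ordAngle_strictMono hq).monotone this.2
  have hcos : ∀ z ∈ Icc (0 : ℝ) (1 / 2), 0 ≤ cos (ordAngle q (piq q * z)) := fun z hz =>
    cos_nonneg_of_neg_pi_div_two_le_of_le (by linarith [pi_pos, (hmem z hz).1]) (hmem z hz).2
  have hle : ordAngle q (piq q * x) ≤ ordAngle q (piq q * y) :=
    (ordAngle_strictMono hq).monotone (mul_le_mul_of_nonneg_left hxy (piq_pos hq).le)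
  refine mul_le_mul_of_nonneg_left ?_ (piq_pos hq).le
  rw [genCos, genCos, oddPow_of_nonneg (by linarith) (hcos x hx),
    oddPow_of_nonneg (by linarith) (hcos y hy)]
  refine rpow_le_rpow (hcos y hy) ?_ (by linarith)
  exact cos_le_cos_of_nonneg_of_le_pi (hmem x hx).1 (by linarith [(hmem y hy).2, pi_pos]) hle

/-- The derivative decreases, so the profile is concave and lies above its chord from `(0,0)` to
`(1/2,1)`. -/
theorem two_mul_le_profile (hq : 1 < q) {x : ℝ} (hx : x ∈ Icc (0 : ℝ) (1 / 2)) :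
    2 * x ≤ profile q x := by
  have hd : deriv (profile q) = profileDeriv q := funext fun x => (hasDerivAt_profile hq x).deriv
  have hc : ConcaveOn ℝ (Icc 0 (1 / 2)) (profile q) :=
    AntitoneOn.concaveOn_of_deriv (convex_Icc _ _) (continuous_profile hq).continuousOn
      (fun x _ => (hasDerivAt_profile hq x).differentiableAt.differentiableWithinAt)
      (hd ▸ (antitoneOn_profileDeriv hq).mono interior_subset)
  have hc2 := hc.2
  have h := hc2 (left_mem_Icc.2 (by norm_num)) (right_mem_Icc.2 (by norm_num))
    (a := 1 - 2 * x) (b := 2 * x) (by linarith [hx.2]) (by linarith [hx.1]) (by ring)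
  simp only [smul_eq_mul, profile_zero hq, profile_half hq] at h
  rw [show (1 - 2 * x) * 0 + 2 * x * (1 / 2) = x by ring] at h
  linarith

/-- On this interval `s = sin_q` and `c = cos_q` lie in `[0,1]`, so `1 = s^q + c^q ≤ s + c`. -/
theorem one_sub_profile_le (hq : 1 < q) {x : ℝ} (hx : x ∈ Icc (0 : ℝ) (1 / 2)) :
    1 - profile q x ≤ (piq q)⁻¹ * profileDeriv q x := by
  obtain ⟨hs, hc⟩ := genSin_mem_quarter hq (piq_mul_mem_quarter hq hx)
  have h := abs_genSin_rpow_add_abs_genCos_rpow hq (piq q * x)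
  have hs1 := abs_genSin_le_one hq (piq q * x)
  have hc1 := abs_genCos_le_one hq (piq q * x)
  rw [abs_of_nonneg hs] at h hs1
  rw [abs_of_nonneg hc] at h hc1
  rw [profileDeriv, inv_mul_cancel_left₀ (piq_pos hq).ne', profile]
  linarith [rpow_le_self_of_le_one hs hs1 hq.le, rpow_le_self_of_le_one hc hc1 hq.le]

/-- Bernoulli's inequality applied to `cos_q = (1 - sin_q^q)^{1/q}`. -/
theorem profileDeriv_le (hq : 1 < q) {x : ℝ} (hx : x ∈ Icc (0 : ℝ) (1 / 2)) :
    profileDeriv q x ≤ piq q * (1 - |profile q x| ^ q / q) := by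
  have hc := (genSin_mem_quarter hq (piq_mul_mem_quarter hq hx)).2
  have h := abs_genSin_rpow_add_abs_genCos_rpow hq (piq q * x)
  refine mul_le_mul_of_nonneg_left ?_ (piq_pos hq).le
  have h1 : genCos q (piq q * x) = (1 + -|profile q x| ^ q) ^ (1 / q) := by
    rw [profile, ← sub_eq_add_neg, ← eq_sub_of_add_eq' h, ← rpow_mul (abs_nonneg _),
      mul_one_div_cancel (by linarith), rpow_one, abs_of_nonneg hc]
  have h2 : |profile q x| ^ q ≤ 1 := rpow_le_one (abs_nonneg _) (abs_profile_le_one hq x)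
    (by linarith)
  rw [h1]
  refine (rpow_one_add_le_one_add_mul_self (by linarith) (by positivity) ?_).trans (le_of_eq ?_)
  · rw [div_le_one (by linarith)]
    exact hq.le
  · ring

theorem integral_eq_two_mul_of_symm {f : ℝ → ℝ} (hf : Continuous f) (h : ∀ x, f (1 - x) = f x) :
    ∫ x in (0 : ℝ)..1, f x = 2 * ∫ x in (0 : ℝ)..1 / 2, f x := by
  have h1 := intervalIntegral.integral_comp_sub_left (a := 0) (b := 1 / 2) f 1
  simp only [h, sub_zero] at h1
  rw [← intervalIntegral.integral_add_adjacent_intervals (hf.intervalIntegrable 0 (1 / 2))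
    (hf.intervalIntegrable (1 / 2) 1), two_mul]
  norm_num at h1 ⊢
  exact h1.symm

theorem integral_profileDeriv_half (hq : 1 < q) :
    ∫ x in (0 : ℝ)..1 / 2, profileDeriv q x = 1 := by
  rw [intervalIntegral.integral_eq_sub_of_hasDerivAt (fun x _ => hasDerivAt_profile hq x)
    ((continuous_profileDeriv hq).intervalIntegrable _ _), profile_half hq, profile_zero hq,
    sub_zero]

theorem quarter_le_integral_profile (hq : 1 < q) :
    1 / 4 ≤ ∫ x in (0 : ℝ)..1 / 2, profile q x := by
  have h : ∫ x in (0 : ℝ)..1 / 2, 2 * x = 1 / 4 := by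
    rw [intervalIntegral.integral_const_mul, integral_id]
    norm_num
  rw [← h]
  exact intervalIntegral.integral_mono_on (by norm_num)
    (Continuous.intervalIntegrable (by fun_prop) _ _)
    ((continuous_profile hq).intervalIntegrable _ _) fun x hx => two_mul_le_profile hq hx

theorem half_sub_le_integral_profile (hq : 1 < q) :
    1 / 2 - (piq q)⁻¹ ≤ ∫ x in (0 : ℝ)..1 / 2, profile q x := by
  have hi := (continuous_profile hq).intervalIntegrable (μ := volume) 0 (1 / 2)
  have hd := (continuous_profileDeriv hq).intervalIntegrable (μ := volume) 0 (1 / 2)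
  have h := intervalIntegral.integral_mono_on (by norm_num) (intervalIntegrable_const.sub hi)
    (hd.const_mul (piq q)⁻¹) fun x hx => one_sub_profile_le hq hx
  rw [intervalIntegral.integral_const_mul, integral_profileDeriv_half hq,
    intervalIntegral.integral_sub intervalIntegrable_const hi] at h
  simp only [intervalIntegral.integral_const, smul_eq_mul] at h
  linarith

/-- Bounding one factor of `(f')²` by `profileDeriv_le` leaves `π_q (1 - f^q/q) f'`, which is an
exact derivative on the half interval. -/
theorem integral_profileDeriv_sq_le (hq : 1 < q) :
    ∫ x in (0 : ℝ)..1, profileDeriv q x * profileDeriv q x ≤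
      2 * (piq q * (1 - 1 / (q * (q + 1)))) := by
  have hcd := continuous_profileDeriv hq
  rw [integral_eq_two_mul_of_symm (hcd.fun_mul hcd) fun x => by simp [profileDeriv_one_sub hq]]
  refine mul_le_mul_of_nonneg_left ?_ zero_le_two
  have hpow : ∀ x ∈ Icc (0 : ℝ) (1 / 2), |profile q x| ^ (q + 1 - 2) * profile q x =
      |profile q x| ^ q := by
    intro x hx
    rw [abs_of_nonneg (profile_nonneg hq hx)]
    nth_rw 2 [← rpow_one (profile q x)]
    rw [← rpow_add' (profile_nonneg hq hx) (by linarith)]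
    congr 1
    ring
  have hW : ∀ x ∈ uIcc (0 : ℝ) (1 / 2),
      HasDerivAt (fun x => piq q * (profile q x - |profile q x| ^ (q + 1) / (q * (q + 1))))
        (piq q * (profileDeriv q x - |profile q x| ^ (q + 1 - 2) * profile q x *
          profileDeriv q x / q)) x := by
    intro x _
    have h1 := ((hasDerivAt_abs_rpow (profile q x) (p := q + 1) (by linarith)).comp x
      (hasDerivAt_profile hq x)).div_const (q * (q + 1))
    refine (((hasDerivAt_profile hq x).sub h1).const_mul (piq q)).congr_deriv ?_
    have : q + 1 ≠ 0 := by linarith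
    field_simp
  have hcont : Continuous fun x => piq q * (profileDeriv q x -
      |profile q x| ^ (q + 1 - 2) * profile q x * profileDeriv q x / q) := by
    have h1 := (continuous_profile hq).abs.rpow_const (p := q + 1 - 2)
      fun x => Or.inr (by linarith)
    exact continuous_const.mul (hcd.sub (((h1.mul (continuous_profile hq)).mul hcd).div_const q))
  have h := intervalIntegral.integral_mono_on (μ := volume) (by norm_num)
    ((hcd.fun_mul hcd).intervalIntegrable 0 (1 / 2)) (hcont.intervalIntegrable 0 (1 / 2)) (by
      intro x hx
      rw [hpow x hx]
      have := mul_le_mul_of_nonneg_right (profileDeriv_le hq hx) (profileDeriv_nonneg hq hx)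
      refine this.trans (le_of_eq ?_)
      ring)
  rw [intervalIntegral.integral_eq_sub_of_hasDerivAt hW (hcont.intervalIntegrable _ _)] at h
  refine h.trans (le_of_eq ?_)
  rw [profile_half hq, profile_zero hq, abs_zero, zero_rpow (by linarith), abs_one, one_rpow]
  ring

/-- The first `q`-sine function, dilated by `n`, as a bounded continuous function. -/
noncomputable def profileFun (hq : 1 < q) (n : ℕ) : BoundedContinuousFunction ℝ ℝ :=
  BoundedContinuousFunction.ofNormedAddCommGroup (fun x => profile q (n * x))
    ((continuous_profile hq).comp (by fun_prop)) 1 fun x => abs_profile_le_one hq _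

/-- The derivative of the first `q`-sine function as a bounded continuous function. -/
noncomputable def profileDerivFun (hq : 1 < q) : BoundedContinuousFunction ℝ ℝ :=
  BoundedContinuousFunction.ofNormedAddCommGroup (profileDeriv q) (continuous_profileDeriv hq)
    (piq q) fun x => abs_profileDeriv_le hq x

theorem profileFun_apply (hq : 1 < q) (n : ℕ) (x : ℝ) : profileFun hq n x = profile q (n * x) := rfl

/-- The sine Fourier coefficients of the first `q`-sine function. -/
noncomputable def sineCoeff (q : ℝ) (m : ℕ) : ℝ :=
  ∫ x in (0 : ℝ)..1, √2 * sin (m * π * x) * profile q x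

/-- The cosine Fourier coefficients of the derivative of the first `q`-sine function. -/
noncomputable def cosineCoeff (q : ℝ) (m : ℕ) : ℝ :=
  ∫ x in (0 : ℝ)..1, √2 * cos (m * π * x) * profileDeriv q x

theorem cosineCoeff_eq (hq : 1 < q) (m : ℕ) : cosineCoeff q m = m * π * sineCoeff q m := by
  have hu : ∀ x ∈ uIcc (0 : ℝ) 1, HasDerivAt (fun x => √2 * cos (m * π * x))
      (-(m * π) * (√2 * sin (m * π * x))) x := by
    intro x _
    have h1 : HasDerivAt (fun x => m * π * x) (m * π) x := by
      simpa using (hasDerivAt_id x).const_mul (m * π)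
    exact (h1.cos.const_mul √2).congr_deriv (by ring)
  rw [cosineCoeff, intervalIntegral.integral_mul_deriv_eq_deriv_mul hu
    (fun x _ => hasDerivAt_profile hq x) (Continuous.intervalIntegrable (by fun_prop) _ _)
    ((continuous_profileDeriv hq).intervalIntegrable _ _), profile_zero hq, profile_one hq,
    sineCoeff, ← intervalIntegral.integral_const_mul]
  simp only [mul_zero, sub_zero, zero_sub, ← intervalIntegral.integral_neg]
  refine intervalIntegral.integral_congr fun x _ => ?_
  ring

theorem sineCoeff_of_even (hq : 1 < q) {m : ℕ} (hm : Even m) : sineCoeff q m = 0 := by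
  have h := intervalIntegral.integral_comp_sub_left (a := 0) (b := 1)
    (fun x => √2 * sin (m * π * x) * profile q x) 1
  have h2 : ∀ x, √2 * sin (m * π * (1 - x)) * profile q (1 - x) =
      -(√2 * sin (m * π * x) * profile q x) := by
    intro x
    obtain ⟨k, rfl⟩ := hm
    have : ((k + k : ℕ) : ℝ) * π * (1 - x) = k * (2 * π) - ((k + k : ℕ) : ℝ) * π * x := by
      push_cast
      ring
    rw [profile_one_sub hq, this, sin_nat_mul_two_pi_sub]
    ring
  simp only [h2, sub_self, sub_zero, intervalIntegral.integral_neg] at h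
  unfold sineCoeff
  linarith

/-- Replace `cos (π x)` by its chord `1 - 2x` on `[0,1/2]` and integrate by parts; the boundary
terms vanish. -/
theorem le_cosineCoeff_one (hq : 1 < q) :
    4 * √2 * ∫ x in (0 : ℝ)..1 / 2, profile q x ≤ cosineCoeff q 1 := by
  have hcd := continuous_profileDeriv hq
  have hc : Continuous fun x => √2 * cos ((1 : ℕ) * π * x) * profileDeriv q x :=
    (by fun_prop : Continuous fun x : ℝ => √2 * cos ((1 : ℕ) * π * x)).mul hcd
  rw [cosineCoeff, integral_eq_two_mul_of_symm hc (by
    intro x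
    rw [profileDeriv_one_sub hq, show ((1 : ℕ) : ℝ) * π * (1 - x) = π - (1 : ℕ) * π * x by
      push_cast; ring, cos_pi_sub]
    ring)]
  have hu : ∀ x ∈ uIcc (0 : ℝ) (1 / 2), HasDerivAt (fun x : ℝ => √2 * (1 - 2 * x)) (-2 * √2) x := by
    intro x _
    have := (((hasDerivAt_id x).const_mul 2).const_sub 1).const_mul √2
    exact this.congr_deriv (by ring)
  have hparts := intervalIntegral.integral_mul_deriv_eq_deriv_mul hu
    (fun x _ => hasDerivAt_profile hq x) intervalIntegrable_const
    (hcd.intervalIntegrable _ _)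
  rw [intervalIntegral.integral_const_mul, profile_zero hq, profile_half hq] at hparts
  have hmono := intervalIntegral.integral_mono_on (μ := volume) (a := 0) (b := 1 / 2) (by norm_num)
    (Continuous.intervalIntegrable
      (((by fun_prop : Continuous fun x : ℝ => √2 * (1 - 2 * x))).mul hcd) _ _)
    (hc.intervalIntegrable _ _) (by
      intro x hx
      have h1 := one_sub_mul_le_cos (x := π * x) (mul_nonneg pi_pos.le hx.1)
        (by nlinarith [hx.2, pi_pos])
      rw [← mul_assoc, div_mul_cancel₀ _ pi_ne_zero] at h1
      simp only [Nat.cast_one, one_mul]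
      exact mul_le_mul_of_nonneg_right (mul_le_mul_of_nonneg_left h1 (sqrt_nonneg 2))
        (profileDeriv_nonneg hq hx))
  simp only [Pi.mul_apply] at hmono
  rw [hparts] at hmono
  linarith

end Profile

/-! ### Numerical bounds on `π_q`. -/

section Numerics

open Real

/-- Concavity of `sin` on `[0,π]` makes `sin (π x) / x` decreasing, so `q sin (π/q) ≥ sin (π t) / t`
when `1/q ≤ t`. -/
theorem piq_le_of_le {q t s : ℝ} (hq : 1 < q) (ht : 0 < t) (ht1 : t < 1) (hqt : 1 / q ≤ t)
    (hs : 0 < s) (hst : s ≤ sin (π * t)) : piq q ≤ 2 * π * t / s := by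
  have hq0 : 0 < q := by linarith
  have hmem : ∀ x ∈ Icc (0 : ℝ) 1, π * x ∈ Icc 0 π := fun x hx =>
    ⟨mul_nonneg pi_pos.le hx.1, mul_le_of_le_one_right pi_pos.le hx.2⟩
  have hc := strictConcaveOn_sin_Icc.concaveOn.2
  have h := hc (hmem 0 (by simp)) (hmem t ⟨ht.le, ht1.le⟩) (a := 1 - 1 / (q * t)) (b := 1 / (q * t))
    (by
      rw [sub_nonneg, div_le_one (by positivity)]
      rw [div_le_iff₀ hq0] at hqt
      linarith) (by positivity) (by ring)
  have he : (1 - 1 / (q * t)) • (π * 0) + (1 / (q * t)) • (π * t) = π / q := by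
    simp only [smul_eq_mul]
    field_simp
    ring
  rw [he] at h
  simp only [mul_zero, sin_zero, zero_add, smul_eq_mul] at h
  have h2 : s / t ≤ q * sin (π / q) := by
    have : 1 / (q * t) * s ≤ sin (π / q) := (mul_le_mul_of_nonneg_left hst (by positivity)).trans h
    calc s / t = q * (1 / (q * t) * s) := by field_simp
      _ ≤ _ := mul_le_mul_of_nonneg_left this hq0.le
  rw [piq]
  calc 2 * π / (q * sin (π / q)) ≤ 2 * π / (s / t) :=
        div_le_div_of_nonneg_left (by positivity) (by positivity) h2
    _ = _ := by field_simp

theorem two_pi_div_le_piq {q : ℝ} (hq : 1 < q) : 2 * π / q ≤ piq q := by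
  have hs : 0 < sin (π / q) := by
    refine sin_pos_of_pos_of_lt_pi (by positivity) ?_
    rw [div_lt_iff₀ (by linarith)]
    nlinarith [pi_pos]
  exact div_le_div_of_nonneg_left (by positivity) (by positivity)
    (mul_le_of_le_one_right (by linarith) (sin_le_one _))

theorem piq_le_of_three_halves_le {q : ℝ} (hq : 3 / 2 ≤ q) : piq q ≤ 4.9 := by
  have hs : sin (π * (2 / 3)) = √3 / 2 := by
    rw [show π * (2 / 3) = π - π / 3 by ring, sin_pi_sub, sin_pi_div_three]
  have h3 : (1.73 : ℝ) < √3 := by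
    rw [lt_sqrt (by norm_num)]
    norm_num
  have h := piq_le_of_le (q := q) (t := 2 / 3) (s := 1.73 / 2) (by linarith) (by norm_num)
    (by norm_num) (by rw [div_le_iff₀ (by linarith)]; linarith) (by norm_num)
    (by rw [hs]; linarith)
  refine h.trans ?_
  rw [div_le_iff₀ (by norm_num)]
  linarith [pi_lt_d4]

theorem piq_le_of_twelve_elevenths_le {q : ℝ} (hq : 12 / 11 ≤ q) : piq q ≤ 22.4 := by
  have hs : 0.2573 ≤ sin (π * (11 / 12)) := by
    rw [show π * (11 / 12) = π - π / 12 by ring, sin_pi_sub]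
    have h1 := sin_gt_sub_cube (x := π / 12) (by positivity)
    have h2 : (π / 12) ^ 3 ≤ (0.2618 : ℝ) ^ 3 := by
      refine pow_le_pow_left₀ (by positivity) ?_ 3
      linarith [pi_lt_d4]
    norm_num at h2
    linarith [pi_gt_d4]
  have h := piq_le_of_le (q := q) (t := 11 / 12) (s := 0.2573) (by linarith) (by norm_num)
    (by norm_num) (by rw [div_le_iff₀ (by linarith)]; linarith) (by norm_num) hs
  refine h.trans ?_
  rw [div_le_iff₀ (by norm_num)]
  linarith [pi_lt_d4]

/-- The inequality behind the Riesz basis property for `q ≥ 12/11`. -/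
theorem energy_lt {q I : ℝ} (hq : 12 / 11 ≤ q) (h1 : 1 / 4 ≤ I) (h2 : 1 / 2 - (piq q)⁻¹ ≤ I) :
    piq q * (1 - 1 / (q * (q + 1))) * (π ^ 2 - 8) < 16 * π ^ 2 * I ^ 2 := by
  have hq1 : 1 < q := by linarith
  have hP := piq_pos hq1
  have hpi1 : 9.869 < π ^ 2 := by nlinarith [pi_gt_d4]
  have hpi2 : π ^ 2 < 9.8697 := by nlinarith [pi_lt_d4, pi_pos]
  -- For `q ≥ 3/2`, `π_q` is small enough for the crude bound `I ≥ 1/4`. Near `q = 1` it is large,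
  -- and both the bound `I ≥ 1/2 - 1/π_q` and the energy factor `11/15` are used.
  rcases le_total (3 / 2) q with h | h
  · have hc : piq q * (1 - 1 / (q * (q + 1))) ≤ 4.9 := by
      refine le_trans (mul_le_of_le_one_right hP.le ?_) (piq_le_of_three_halves_le h)
      have : 0 < 1 / (q * (q + 1)) := by positivity
      linarith
    have hI : 1 / 16 ≤ I ^ 2 := by nlinarith
    nlinarith
  · have hc : 1 - 1 / (q * (q + 1)) ≤ 11 / 15 := by
      have : 4 / 15 ≤ 1 / (q * (q + 1)) := by
        rw [div_le_div_iff₀ (by norm_num) (by positivity)]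
        nlinarith
      linarith
    have hP1 : 4.18 ≤ piq q := by
      refine le_trans ?_ (two_pi_div_le_piq hq1)
      rw [le_div_iff₀ (by linarith)]
      nlinarith [pi_gt_d4]
    have hP2 := piq_le_of_twelve_elevenths_le hq
    have hI0 : 0 ≤ 1 / 2 - (piq q)⁻¹ := by
      rw [sub_nonneg, inv_le_comm₀ hP (by norm_num)]
      norm_num
      linarith
    have hI : (1 / 2 - (piq q)⁻¹) ^ 2 ≤ I ^ 2 := pow_le_pow_left₀ hI0 h2 2
    generalize piq q = P at *
    have hI' : (1 / 2 - P⁻¹) ^ 2 = (P - 2) ^ 2 / (4 * P ^ 2) := by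
      field_simp
      ring
    -- This cubic inequality fails for large `P` and for `P` near `2`, so both bounds on `P` matter.
    -- The upper one is where `q ≥ 12/11` enters.
    have hpoly : P ^ 3 * 1.3712 < 39.476 * (P - 2) ^ 2 := by
      nlinarith [mul_nonneg (mul_nonneg (sub_nonneg.2 hP1) (sub_nonneg.2 hP2)) hP.le,
        mul_nonneg (sub_nonneg.2 hP1) (sub_nonneg.2 hP2)]
    calc P * (1 - 1 / (q * (q + 1))) * (π ^ 2 - 8) ≤ P * (11 / 15) * 1.8697 := by
          refine mul_le_mul (mul_le_mul_of_nonneg_left hc hP.le) (by linarith) (by linarith)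
            (by positivity)
      _ ≤ P * 1.3712 := by nlinarith
      _ < 16 * 9.869 * ((P - 2) ^ 2 / (4 * P ^ 2)) := by
          rw [← mul_div_assoc, lt_div_iff₀ (by positivity)]
          nlinarith
      _ ≤ 16 * π ^ 2 * I ^ 2 := by
          rw [hI'] at hI
          refine mul_le_mul (by linarith) hI (by positivity) (by positivity)

end Numerics

/-! ### Summability bounds for the sine coefficients. -/

section Coefficients

open Real

/-- The inverse squares of the odd numbers. -/
noncomputable def oddInvSq (m : ℕ+) : ℝ := if Odd (m : ℕ) then 1 / (m : ℝ) ^ 2 else 0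

theorem hasSum_oddInvSq : HasSum oddInvSq (π ^ 2 / 8) := by
  have h1 := hasSum_zeta_two
  have h2 : HasSum (fun k : ℕ => 1 / ((2 * k : ℕ) : ℝ) ^ 2) (π ^ 2 / 24) := by
    have := h1.mul_left (1 / 4)
    rw [show 1 / 4 * (π ^ 2 / 6) = π ^ 2 / 24 by ring] at this
    refine this.congr_fun fun k => ?_
    push_cast
    rw [mul_pow, one_div, one_div, one_div, mul_inv]
    norm_num
  have h3 : Summable fun k : ℕ => 1 / ((2 * k + 1 : ℕ) : ℝ) ^ 2 :=
    h1.summable.comp_injective (i := fun k => 2 * k + 1) fun a b h => by simpa using h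
  have h4 : ∑' k : ℕ, 1 / ((2 * k + 1 : ℕ) : ℝ) ^ 2 = π ^ 2 / 8 := by
    have := (h2.even_add_odd (f := fun n : ℕ => 1 / (n : ℝ) ^ 2) h3.hasSum).unique h1
    linarith
  let i : ℕ → ℕ+ := fun k => ⟨2 * k + 1, by omega⟩
  have hinj : Function.Injective i := by
    intro a b h
    have := congrArg PNat.val h
    simpa [i] using this
  rw [← hinj.hasSum_iff, ← h4]
  · refine h3.hasSum.congr_fun fun k => ?_
    exact if_pos ⟨k, rfl⟩
  · intro m hm
    rw [oddInvSq, if_neg]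
    rintro ⟨k, hk⟩
    exact hm ⟨k, PNat.eq hk.symm⟩

variable {q : ℝ}

theorem inner_cosineFun_profileDeriv (hq : 1 < q) (m : ℕ) :
    inner ℝ (toL2 (cosineFun m)) (toL2 (profileDerivFun hq)) = cosineCoeff q m := by
  rw [inner_toL2]
  rfl

theorem norm_sq_profileDeriv (hq : 1 < q) : ‖toL2 (profileDerivFun hq)‖ ^ 2 =
    ∫ x in (0 : ℝ)..1, profileDeriv q x * profileDeriv q x := by
  rw [← real_inner_self_eq_norm_sq, inner_toL2]
  rfl

theorem norm_profileDeriv_le (hq : 1 < q) : ‖toL2 (profileDerivFun hq)‖ ≤ piq q := by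
  refine abs_le_of_sq_le_sq' ?_ (piq_pos hq).le |>.2
  rw [norm_sq_profileDeriv]
  have hcd := continuous_profileDeriv hq
  have h := intervalIntegral.integral_mono_on (μ := volume) zero_le_one
    ((hcd.fun_mul hcd).intervalIntegrable 0 1)
    (intervalIntegrable_const (c := piq q ^ 2)) fun x _ => by
      rw [← abs_mul_abs_self, ← sq]
      exact pow_le_pow_left₀ (abs_nonneg _) (abs_profileDeriv_le hq x) 2
  simpa using h

theorem summable_cosineCoeff_sq (hq : 1 < q) : Summable fun m : ℕ+ => cosineCoeff q m ^ 2 := by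
  simpa [inner_cosineFun_profileDeriv] using
    orthonormal_cosine.inner_products_summable (toL2 (profileDerivFun hq))

theorem tsum_cosineCoeff_sq_le (hq : 1 < q) :
    ∑' m : ℕ+, cosineCoeff q m ^ 2 ≤ ‖toL2 (profileDerivFun hq)‖ ^ 2 := by
  simpa [inner_cosineFun_profileDeriv] using
    orthonormal_cosine.tsum_inner_products_le (toL2 (profileDerivFun hq))

/-- AM-GM with a free weight `c` applied to `|a_m| = |b_m| / (mπ)`; optimizing `c` after summation
plays the role of Cauchy-Schwarz. -/
theorem abs_sineCoeff_le (hq : 1 < q) {c : ℝ} (hc : 0 < c) (m : ℕ+) :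
    |sineCoeff q m| ≤ (c * cosineCoeff q m ^ 2 + oddInvSq m / c) / (2 * π) := by
  rcases Nat.even_or_odd (m : ℕ) with hm | hm
  · rw [sineCoeff_of_even hq hm, oddInvSq, if_neg (Nat.not_odd_iff_even.2 hm), abs_zero]
    positivity
  · have hm0 : (0 : ℝ) < m := by exact_mod_cast m.pos
    rw [oddInvSq, if_pos hm, cosineCoeff_eq hq, le_div_iff₀ (by positivity),
      ← sq_abs (_ * sineCoeff q m), abs_mul, abs_of_pos (by positivity : (0 : ℝ) < m * π)]
    generalize |sineCoeff q m| = a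
    have h : c * ((m : ℝ) * π * a) ^ 2 + 1 / (m : ℝ) ^ 2 / c - a * (2 * π) =
        (c * (m * π * a) - 1 / m) ^ 2 / c := by
      field_simp
      ring
    have h2 : 0 ≤ (c * ((m : ℝ) * π * a) - 1 / m) ^ 2 / c := by positivity
    linarith

theorem summable_bound (hq : 1 < q) (c : ℝ) :
    Summable fun m : ℕ+ => (c * cosineCoeff q m ^ 2 + oddInvSq m / c) / (2 * π) :=
  (((summable_cosineCoeff_sq hq).mul_left c).add (hasSum_oddInvSq.summable.div_const c)).div_const _

theorem tsum_bound_le (hq : 1 < q) {c : ℝ} (hc : 0 < c) :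
    ∑' m : ℕ+, (c * cosineCoeff q m ^ 2 + oddInvSq m / c) / (2 * π) ≤
      (c * ‖toL2 (profileDerivFun hq)‖ ^ 2 + π ^ 2 / 8 / c) / (2 * π) := by
  rw [tsum_div_const, Summable.tsum_add ((summable_cosineCoeff_sq hq).mul_left c)
    (hasSum_oddInvSq.summable.div_const c), tsum_mul_left, tsum_div_const, hasSum_oddInvSq.tsum_eq]
  gcongr
  exact tsum_cosineCoeff_sq_le hq

theorem summable_sineCoeff (hq : 1 < q) : Summable fun m : ℕ+ => |sineCoeff q m| :=
  Summable.of_nonneg_of_le (fun _ => abs_nonneg _) (fun m => abs_sineCoeff_le hq one_pos m)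
    (summable_bound hq 1)

theorem tsum_sineCoeff_le (hq : 1 < q) :
    ∑' m : ℕ+, |sineCoeff q m| ≤ piq q / (2 * √2) := by
  have hP := piq_pos hq
  -- This weight minimizes `c π_q² + (π²/8)/c`.
  have hc : 0 < π / (2 * √2 * piq q) := by positivity
  refine ((summable_sineCoeff hq).tsum_le_tsum (fun m => abs_sineCoeff_le hq hc m)
    (summable_bound hq _)).trans ((tsum_bound_le hq hc).trans ?_)
  have h1 : ‖toL2 (profileDerivFun hq)‖ ^ 2 ≤ piq q ^ 2 :=
    pow_le_pow_left₀ (norm_nonneg _) (norm_profileDeriv_le hq) 2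
  have h2 : (√2) ^ 2 = 2 := sq_sqrt zero_le_two
  calc _ ≤ (π / (2 * √2 * piq q) * piq q ^ 2 + π ^ 2 / 8 / (π / (2 * √2 * piq q))) / (2 * π) := by
        gcongr
    _ = _ := by
        field_simp
        rw [h2]
        ring

theorem tsum_sineCoeff_lt (hq : 12 / 11 ≤ q) :
    ∑' m : ℕ+, |sineCoeff q m| < 2 * sineCoeff q 1 := by
  have hq1 : 1 < q := by linarith
  have hP := piq_pos hq1
  set E := ‖toL2 (profileDerivFun hq1)‖ ^ 2 with hE
  have hE1 : E ≤ 2 * (piq q * (1 - 1 / (q * (q + 1)))) := by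
    rw [hE, norm_sq_profileDeriv]
    exact integral_profileDeriv_sq_le hq1
  set I := ∫ x in (0 : ℝ)..1 / 2, profile q x
  have hI := quarter_le_integral_profile hq1
  have hen := energy_lt hq hI (half_sub_le_integral_profile hq1)
  have hb := le_cosineCoeff_one hq1
  set b := cosineCoeff q 1 with hbdef
  have hpos : 0 < 4 * √2 * I := by positivity
  have hb0 : 0 < b := hpos.trans_le hb
  have hb2 : 32 * I ^ 2 ≤ b ^ 2 := by
    have := pow_le_pow_left₀ hpos.le hb 2
    rw [mul_pow, mul_pow, sq_sqrt zero_le_two] at this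
    linarith
  have hpi : 8 < π ^ 2 := by nlinarith [pi_gt_d4]
  have hmain : E * (π ^ 2 - 8) < b ^ 2 * π ^ 2 := by
    have h1 := mul_le_mul_of_nonneg_right hE1 (by linarith : 0 ≤ π ^ 2 - 8)
    have h2 := mul_le_mul_of_nonneg_right hb2 (by positivity : 0 ≤ π ^ 2)
    linarith
  have hab : b = π * sineCoeff q 1 := by
    rw [hbdef, cosineCoeff_eq hq1]
    simp
  -- With this weight the tail's `(π²/8 - 1)/c` equals `b`, and what remains, `c (E - b²) < b`, is a
  -- rearrangement of `hmain`.
  set c := (π ^ 2 / 8 - 1) / b with hcdef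
  have hc : 0 < c := div_pos (by linarith) hb0
  have hs := summable_sineCoeff hq1
  have hsb := summable_bound hq1 c
  -- Keeping the AM-GM loss at `m = 1` means that the estimate is spent only on the terms `m ≥ 2`.
  have h1 := (hsb.sub hs).le_tsum 1 fun m _ => sub_nonneg.2 (abs_sineCoeff_le hq1 hc m)
  rw [hsb.tsum_sub hs] at h1
  have h2 := tsum_bound_le hq1 hc
  have ha : 0 < sineCoeff q 1 := by
    rw [hab] at hb0
    exact (pos_iff_pos_of_mul_pos hb0).1 pi_pos
  have h3 : oddInvSq 1 = 1 := by simp [oddInvSq]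
  simp only [PNat.one_coe, abs_of_pos ha, h3, ← hbdef, ← hE] at h1 h2
  have hkey : (c * E + π ^ 2 / 8 / c) / (2 * π) - (c * b ^ 2 + 1 / c) / (2 * π) <
      sineCoeff q 1 := by
    have hb' : sineCoeff q 1 = b / π := by
      rw [hab]
      field_simp
    have h4 : c * E + π ^ 2 / 8 / c - (c * b ^ 2 + 1 / c) = c * (E - b ^ 2) + b := by
      have : π ^ 2 / 8 - 1 ≠ 0 := by linarith
      have hcb : (π ^ 2 / 8 - 1) / c = b := div_div_cancel₀ this
      rw [sub_div] at hcb
      linear_combination hcb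
    have h5 : c * (E - b ^ 2) < b := by
      rw [hcdef, div_mul_eq_mul_div, div_lt_iff₀ hb0]
      linarith
    rw [← sub_div, h4, hb', div_lt_div_iff₀ (by positivity) pi_pos]
    nlinarith [pi_pos]
  linarith

end Coefficients

/-! ### Sine expansion of the dilated profiles. -/

section Expansion

variable {q : ℝ}

theorem summable_smul_sineFun (hq : 1 < q) (n : ℕ) :
    Summable fun m : ℕ+ => sineCoeff q m • sineFun (m * n) := by
  refine Summable.of_norm_bounded ((summable_sineCoeff hq).mul_right √2) fun m => ?_
  rw [norm_smul, Real.norm_eq_abs]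
  exact mul_le_mul_of_nonneg_left (norm_sineFun_le _) (abs_nonneg _)

theorem hasSum_tsum_sineFun_apply (hq : 1 < q) (n : ℕ) (x : ℝ) :
    HasSum (fun m : ℕ+ => sineCoeff q m * (√2 * Real.sin (m * Real.pi * (n * x))))
      ((∑' m : ℕ+, sineCoeff q m • sineFun (m * n)) x) := by
  have h := (summable_smul_sineFun hq n).hasSum.mapL
    (BoundedContinuousFunction.evalCLM ℝ x : BoundedContinuousFunction ℝ ℝ →L[ℝ] ℝ)
  refine h.congr_fun fun m => ?_
  simp only [BoundedContinuousFunction.evalCLM_apply, BoundedContinuousFunction.coe_smul,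
    smul_eq_mul, sineFun_apply]
  push_cast
  ring_nf

theorem inner_sine_profile (hq : 1 < q) (m : ℕ) :
    inner ℝ (toL2 (sineFun m)) (toL2 (profileFun hq 1)) = sineCoeff q m := by
  rw [inner_toL2]
  simp [sineFun_apply, profileFun_apply, sineCoeff]

theorem toL2_tsum_sineFun (hq : 1 < q) :
    toL2 (∑' m : ℕ+, sineCoeff q m • sineFun (m * 1)) = toL2 (profileFun hq 1) := by
  have h1 := (summable_smul_sineFun hq 1).hasSum.mapL toL2
  have h2 := sineHilbertBasis.hasSum_repr (toL2 (profileFun hq 1))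
  refine h1.unique (h2.congr_fun fun m => ?_)
  rw [HilbertBasis.repr_apply_apply, sineHilbertBasis_apply, inner_sine_profile, map_smul, mul_one]

/-- The series converges uniformly and agrees with the profile in `L²(0,1)`, hence pointwise on
`(0,1)` by continuity. Both sides are odd and 2-periodic, so they agree on the whole line, which
permits evaluation at `n x`. -/
theorem tsum_sineFun_apply (hq : 1 < q) (x : ℝ) :
    (∑' m : ℕ+, sineCoeff q m • sineFun (m * 1)) x = profile q x := by
  set G := ∑' m : ℕ+, sineCoeff q m • sineFun (m * 1) with hG
  have hGx := hasSum_tsum_sineFun_apply hq 1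
  simp only [Nat.cast_one, one_mul, ← hG] at hGx
  set D : ℝ → ℝ := fun x => G x - profile q x with hD
  have hD01 : ∀ x ∈ Ioo (0 : ℝ) 1, D x = 0 := by
    have h1 : G =ᵐ[volume.restrict (Ioo (0 : ℝ) 1)] profile q := by
      refine (coeFn_toL2 G).symm.trans ?_
      rw [toL2_tsum_sineFun hq]
      refine (coeFn_toL2 _).trans (Filter.Eventually.of_forall fun x => ?_)
      simp [profileFun_apply]
    have h2 := Measure.eqOn_open_of_ae_eq h1 isOpen_Ioo G.continuous.continuousOn
      (continuous_profile hq).continuousOn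
    exact fun x hx => sub_eq_zero.2 (h2 hx)
  have hDneg : ∀ x, D (-x) = -D x := by
    intro x
    have : G (-x) = -G x := by
      refine (hGx (-x)).unique ((hGx x).neg.congr_fun fun m => ?_)
      rw [mul_neg, Real.sin_neg]
      ring
    simp only [hD, this, profile_neg hq]
    ring
  have hDper : Function.Periodic D 2 := by
    intro x
    have h1 : G (x + 2) = G x := by
      refine (hGx (x + 2)).unique ((hGx x).congr_fun fun m => ?_)
      rw [show (m : ℝ) * Real.pi * (x + 2) = m * Real.pi * x + (m : ℕ) * (2 * Real.pi) by ring,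
        Real.sin_add_nat_mul_two_pi]
    have h2 : profile q (x + 2) = profile q x := by
      rw [show x + 2 = x + 1 + 1 by ring, profile_add_one hq, profile_add_one hq, neg_neg]
    simp only [hD, h1, h2]
  obtain ⟨y, hy, hxy⟩ := hDper.exists_mem_Ico two_pos x (-1)
  have hzero : D y = 0 := by
    rcases lt_trichotomy y 0 with h | rfl | h
    · rcases hy.1.eq_or_lt with rfl | h'
      · have h1 := hDper (-1)
        have h2 := hDneg 1
        norm_num at h1
        linarith
      · have := hD01 (-y) ⟨by linarith, by linarith⟩
        rw [hDneg] at this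
        linarith
    · have := hDneg 0
      rw [neg_zero] at this
      linarith
    · exact hD01 y ⟨h, by linarith [hy.2]⟩
  rw [hzero] at hxy
  exact sub_eq_zero.1 hxy

theorem tsum_sineFun (hq : 1 < q) (n : ℕ) :
    ∑' m : ℕ+, sineCoeff q m • sineFun (m * n) = profileFun hq n := by
  ext x
  rw [profileFun_apply, ← tsum_sineFun_apply hq]
  have h := hasSum_tsum_sineFun_apply hq 1 (n * x)
  simp only [Nat.cast_one, one_mul] at h
  exact (hasSum_tsum_sineFun_apply hq n x).unique h

theorem dilationSeries_sine (hq : 1 < q) (n : ℕ+) :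
    dilationSeries sineHilbertBasis (fun m => sineCoeff q m) (sineHilbertBasis n) =
      toL2 (profileFun hq n) := by
  have h1 := hasSum_dilationSeries_apply sineHilbertBasis (summable_sineCoeff hq) n
  have h2 := (summable_smul_sineFun hq n).hasSum.mapL toL2
  rw [tsum_sineFun hq] at h2
  refine h1.unique (h2.congr_fun fun m => ?_)
  rw [sineHilbertBasis_apply, map_smul, PNat.mul_coe]

/-- The image of `e n` involves only multiples of `n`, none of which is smaller than `n`. -/
theorem inner_dilationSeries_eq_zero {H : Type*} [NormedAddCommGroup H] [InnerProductSpace ℝ H]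
    [CompleteSpace H] (e : HilbertBasis ℕ+ ℝ H) {a : ℕ+ → ℝ} (ha : Summable fun m => |a m|)
    {j n : ℕ+} (hjn : j < n) : inner ℝ (e j) (dilationSeries e a (e n)) = (0 : ℝ) := by
  have h := (hasSum_dilationSeries_apply e ha n).mapL (innerSL ℝ (e j))
  refine h.unique (hasSum_zero.congr_fun fun m => ?_)
  have hne : j ≠ m * n := (hjn.trans_le (le_mul_of_one_le_left' one_le)).ne
  simp [e.orthonormal.inner_eq_zero hne]

theorem sum_Icc_eq_sum_pnat {M : Type*} [AddCommMonoid M] (N : ℕ) (F : ℕ → M) :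
    ∑ n ∈ Finset.Icc 1 N, F n = ∑ n ∈ Finset.Ico (1 : ℕ+) N.succPNat, F n := by
  symm
  refine Finset.sum_nbij (fun m : ℕ+ => (m : ℕ)) (fun m hm => ?_) (fun _ _ _ _ h => PNat.eq h)
    (fun n hn => ?_) fun _ _ => rfl
  · have := (Finset.mem_Ico.1 hm).2
    rw [← PNat.coe_lt_coe, Nat.succPNat_coe] at this
    exact Finset.mem_Icc.2 ⟨m.pos, Nat.lt_succ_iff.1 this⟩
  · have h := Finset.mem_Icc.1 hn
    lift n to ℕ+ using h.1
    refine ⟨n, ?_, rfl⟩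
    rw [Finset.mem_coe, Finset.mem_Ico]
    refine ⟨one_le, ?_⟩
    rw [← PNat.coe_lt_coe, Nat.succPNat_coe]
    exact Nat.lt_succ_iff.2 h.2

end Expansion

/-! ### Assembly of the main theorem. -/

theorem lemma3p1 (q : ℝ) (hq : 12 / 11 ≤ q) :
    (∀ n : ℕ, 1 ≤ n → IsQSine q n (qSine q n)) ∧
    ∃ (f fs : ℕ → L2) (T : L2 ≃L[ℝ] L2),
      IsQSineSequence q f ∧
      (∀ n : ℕ, 1 ≤ n → T (sineBasis n) = f n) ∧
      IsDualSequence f fs ∧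
      ∀ (g : L2) (N : ℕ),
        ‖g - dualTruncation f fs N g‖ ≤
          ‖(T.symm : L2 →L[ℝ] L2)‖ * piq q / (2 * √2) * ‖g - sineTruncation N g‖ := by
  have hq1 : 1 < q := by linarith
  refine ⟨fun n hn => isQSine_qSine hq1 hn, ?_⟩
  have ha := summable_sineCoeff hq1
  obtain ⟨T, hT⟩ := exists_equiv_eq_dilationSeries sineHilbertBasis ha
    (by simpa using tsum_sineCoeff_lt hq)
  have hTapp : ∀ x, T x = dilationSeries sineHilbertBasis (fun m => sineCoeff q m) x :=
    fun x => congrArg (fun A : L2 →L[ℝ] L2 => A x) hT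
  have hbasis : ∀ n : ℕ+, sineHilbertBasis n = sineBasis n := fun n => by
    rw [sineHilbertBasis_apply, toL2_sineFun]
  have hTe : ∀ n : ℕ, 1 ≤ n → T (sineBasis n) = toL2 (profileFun hq1 n) := by
    intro n hn
    lift n to ℕ+ using hn
    have := dilationSeries_sine hq1 n
    rwa [← hTapp, hbasis] at this
  refine ⟨fun n => toL2 (profileFun hq1 n),
    fun n => ContinuousLinearMap.adjoint (T.symm : L2 →L[ℝ] L2) (sineBasis n), T, ?_, hTe, ?_, ?_⟩
  · intro n hn
    refine (coeFn_toL2 _).trans ?_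
    filter_upwards [ae_restrict_mem measurableSet_Ioo] with x hx
    rw [qSine_eqOn hq1 hn (Ioo_subset_Icc_self hx), profileFun_apply, profile]
    congr 1
    ring
  · intro j k hj hk
    beta_reduce
    rw [← hTe j hj, ContinuousLinearMap.adjoint_inner_right, ContinuousLinearEquiv.coe_coe,
      ContinuousLinearEquiv.symm_apply_apply, ← toL2_sineFun, ← toL2_sineFun,
      inner_sineFun j k (by omega)]
  · intro g N
    have h := norm_sub_dual_truncation_le sineHilbertBasis T (Finset.Ico 1 N.succPNat) (by
      intro j hj n hn
      rw [hTapp]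
      refine inner_dilationSeries_eq_zero _ ha ((Finset.mem_Ico.1 hj).2.trans_le ?_)
      simpa using hn) g
    have h1 : dualTruncation (fun n => toL2 (profileFun hq1 n))
        (fun n => ContinuousLinearMap.adjoint (T.symm : L2 →L[ℝ] L2) (sineBasis n)) N g =
        ∑ j ∈ Finset.Ico 1 N.succPNat, (inner ℝ g (T (sineHilbertBasis j)) : ℝ) •
          ContinuousLinearMap.adjoint (T.symm : L2 →L[ℝ] L2) (sineHilbertBasis j) := by
      rw [dualTruncation, sum_Icc_eq_sum_pnat]
      refine Finset.sum_congr rfl fun j _ => ?_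
      rw [hbasis, hTe j j.pos]
    have h2 : sineTruncation N g =
        ∑ j ∈ Finset.Ico 1 N.succPNat, (inner ℝ g (sineHilbertBasis j) : ℝ) •
          sineHilbertBasis j := by
      rw [sineTruncation, sum_Icc_eq_sum_pnat]
      refine Finset.sum_congr rfl fun j _ => ?_
      rw [hbasis]
    rw [h1, h2]
    refine h.trans (mul_le_mul_of_nonneg_right ?_ (norm_nonneg _))
    rw [mul_div_assoc]
    refine mul_le_mul_of_nonneg_left ?_ (norm_nonneg _)
    rw [hT]
    exact (norm_dilationSeries_le _ ha).trans (tsum_sineCoeff_le hq1)
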